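/- Network. Base stations (BSs) form a homogeneous Poisson point process $\Phi_b$ of intensity $\varphi_b>0$ in $\mathbb{R}^2$; users have intensity $\varphi_u>0$, and each user requests packets at rate $\lambda>0$ from a library of $C$ packets of size $T>0$ with popularities $f_1\ge\dots\ge f_C\ge 0$, $\sum_i f_i=1$. A fraction $\alpha\in[0,1)$ of the users is cache-enabled and stores the $M\le C$ most popular packets; put $\delta=\sum_{i=1}^M f_i$ and $\bar\lambda=(1-\alpha\delta)\lambda$. Slots have duration $\tau>0$, the bandwidth is $B>0$, the transmission power $P>0$, the noise power $\sigma^2>0$, and the path-loss exponent $\beta>2$. Traffic. The number $N$ of users of a cell is, given the cell size $S=s$, Poisson with mean $\varphi_u s$, where $S$ has density $\frac{(\varphi_bK)^K}{\Gamma(K)}s^{K-1}e^{-\varphi_bKs}$ on $(0,\infty)$ with $K=3.575$. In a cell with $N=n$ users the queue evolves as $q_{k+1}=\max(q_k-1,0)+a_{k+1}$, where the $a_k$ are i.i.d. Poisson with mean $\bar\lambda\tau n$. Let $$p_t=\sum_{n:\,\bar\lambda\tau n\ge 1}\mathbb{P}(N=n),\qquad p_0=\sum_{n:\,\bar\lambda\tau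 n<1}\mathbb{P}(N=n)\lim_{k\to\infty}\mathbb{P}(q_k=0\mid N=n)$$ be the probabilities of a full-load and of a free-load cell. Downlink. Each BS is active, independently of everything else, with probability $1-p_0+p_0p_t$, so that the active BSs form a thinned Poisson process of intensity $\varphi_a=(1-p_0+p_0p_t)\varphi_b$. A typical user without a cache is at the origin and is served by the nearest BS of $\Phi_b$, at distance $d_0$. The interferers are the active BSs other than the serving one, at distances $d_k$ from the user; thus, given $d_0$, they form a Poisson process of intensity $\varphi_a$ outside the disc of radius $d_0$. Fading is Rayleigh: the power gains $|h_0|^2$, $|h_k|^2$ are i.i.d. exponential with mean $1$ and independent of the positions and activities of the BSs. Let $$\mathrm{SINR}=\frac{P|h_0|^2d_0^{-\beta}}{\sum_k P|h_k|^2d_k^{-\beta}+\sigma^2},\qquad \bar T=2^{T/(\tau B)}-1,$$ the sum being over the interferers. Theorem. The interference $\sum_k P|h_k|^2d_k^{-\beta}$ is almost surely finite, and the packet loss rate $\mathcal{P}_{l,u}=\mathbb{P}\big(\tau B\log_2(1+\mathrm{SINR})<T\big)$ is $$\mathcal{P}_{l,u}=1-2\pi\varphi_b\int_0^\infty r\exp\Big\{-\frac{r^\beta\,\bar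 T\sigma^2}{P}-\pi r^2\big[\varphi_aZ_1(\bar T)+\varphi_b\big]\Big\}\,dr,$$ where the integral converges and $$Z_1(\bar T)=\frac{2\bar T}{\beta-2}\;{}_2F_1\Big[1,\,1-\frac2\beta;\,2-\frac2\beta;\,-\bar T\Big],$$ with ${}_2F_1$ the Gauss hypergeometric function (the holomorphic continuation of the hypergeometric series to $\mathbb{C}\setminus[1,\infty)$). -/

import Mathlib

open MeasureTheory ProbabilityTheory Set Filter Topology

noncomputable section

/-- The plane, with its Euclidean norm and Lebesgue measure `volume`. -/
abbrev Plane : Type := EuclideanSpace ℝ (Fin 2)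

/-! ### The Gauss hypergeometric function beyond its disc of convergence -/

/-- `F` is the principal branch of the Gauss hypergeometric function with parameters `a, b, c`:
it is holomorphic on `ℂ ∖ [1, ∞)` and is the hypergeometric series on the unit disc.
(By the identity theorem such an `F` is unique on `ℂ ∖ [1, ∞)`.) -/
def IsGaussHypergeometric (a b c : ℂ) (F : ℂ → ℂ) : Prop :=
  DifferentiableOn ℂ F {z : ℂ | z.im ≠ 0 ∨ z.re < 1} ∧
    ∀ z : ℂ, ‖z‖ < 1 → F z = ordinaryHypergeometric a b c z

open Classical in
/-- The Gauss hypergeometric function `₂F₁[a, b; c; z]`, for `z` in `ℂ ∖ [1, ∞)`. (Mathlib's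
`ordinaryHypergeometric` is only the sum of the series, so it is not the right function
for `‖z‖ ≥ 1`.) -/
def gaussHypergeometric (a b c z : ℂ) : ℂ :=
  if h : ∃ F : ℂ → ℂ, IsGaussHypergeometric a b c F then h.choose z else 0

/-! ### Homogeneous Poisson point processes in the plane -/

section PointProcess

variable {Ω : Type*} [MeasurableSpace Ω]

/-- The number of points of the random sequence `X` that lie in `A`. -/
def pointCount (X : ℕ → Ω → Plane) (A : Set Plane) (ω : Ω) : ℕ∞ :=
  {k : ℕ | X k ω ∈ A}.encard

/-- The random points `X 0, X 1, …` (listed in any order) form a homogeneous Poisson point process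
of intensity `φ` in the plane: the number of points in a Borel set `A` of finite area `|A|` is
Poisson with mean `φ |A|`, and the numbers of points in disjoint Borel sets are independent.
(For `φ > 0` there are almost surely infinitely many points, so a sequence enumerates them.) -/
structure IsPoissonPointProcess (X : ℕ → Ω → Plane) (φ : ℝ) (μ : Measure Ω) : Prop where
  measurable : ∀ k, Measurable (X k)
  count_law : ∀ A : Set Plane, MeasurableSet A → volume A ≠ ⊤ → ∀ n : ℕ,
    μ {ω | pointCount X A ω = n} = poissonMeasure (φ * volume.real A).toNNReal {n}
  count_indep : ∀ (m : ℕ) (A : Fin m → Set Plane), (∀ i, MeasurableSet (A i)) →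
    (∀ i, volume (A i) ≠ ⊤) → Pairwise (fun i j => Disjoint (A i) (A j)) →
    iIndepFun (fun i => pointCount X (A i)) μ

end PointProcess

/-! ### The queue at a base station -/

/-- The law of the number `q_k` of queued requests after the `k`-th slot, when the numbers of
arrivals in the slots are i.i.d. Poisson with mean `a`: the buffer starts empty, and
`q_{k+1} = [q_k - 1]⁺ + a_{k+1}` with `a_{k+1}` independent of `q_k`.
(The subtraction `q - 1` is the truncated one of `ℕ`.) -/
def queueLaw (a : NNReal) : ℕ → Measure ℕ
  | 0 => Measure.dirac 0
  | k + 1 => ((queueLaw a k).map (fun q => q - 1)).conv (poissonMeasure a)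

/-- The equilibrium probability `lim_k P(q_k = 0)` that the queue is empty. -/
def queueEmptyProb (a : NNReal) : ℝ :=
  limUnder atTop (fun k => (queueLaw a k).real {0})

/-! ### The network -/

/-- The parameters of the cache-enabled network. -/
structure CacheNetwork where
  /-- intensity `φ_b` of the base stations -/
  φb : ℝ
  /-- intensity `φ_u` of the users -/
  φu : ℝ
  /-- request rate `λ` of each user -/
  rate : ℝ
  /-- fraction `α` of cache-enabled users -/
  α : ℝ
  /-- number of packets in the library -/
  C : ℕ
  /-- popularity of the packets, in decreasing order -/
  f : Fin C → ℝ
  /-- number of packets that a cache-enabled user caches -/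
  M : ℕ
  /-- packet size -/
  T : ℝ
  /-- slot duration -/
  τ : ℝ
  /-- bandwidth -/
  B : ℝ
  /-- transmission power -/
  P : ℝ
  /-- noise power `σ²` -/
  σsq : ℝ
  /-- path-loss exponent -/
  β : ℝ
  φb_pos : 0 < φb
  φu_pos : 0 < φu
  rate_pos : 0 < rate
  α_nonneg : 0 ≤ α
  α_lt_one : α < 1
  f_nonneg : ∀ i, 0 ≤ f i
  f_sum : ∑ i, f i = 1
  f_antitone : Antitone f
  M_le : M ≤ C
  T_pos : 0 < T
  τ_pos : 0 < τ
  B_pos : 0 < B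
  P_pos : 0 < P
  σsq_pos : 0 < σsq
  two_lt_β : 2 < β

namespace CacheNetwork

variable (N : CacheNetwork)

/-- The cache hit ratio `δ = f_1 + … + f_M`. -/
def hitRatio : ℝ := ∑ i : Fin N.C, if (i : ℕ) < N.M then N.f i else 0

/-- `λ̄ = (1 - α δ) λ`, the request rate per user that reaches the base stations. -/
def meanRate : ℝ := (1 - N.α * N.hitRatio) * N.rate

/-- The mean number `λ̄ τ n` of requests that arrive per slot in a cell with `n` users. -/
def slotLoad (n : ℕ) : ℝ := N.meanRate * N.τ * n

/-- The constant in the law of the cell size. -/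
def cellShape : ℝ := 3.575

/-- The law of the cell size: density `(φ_b K)^K / Γ(K) * s^(K-1) * exp(-φ_b K s)` on `s > 0`. -/
def cellSizeLaw : Measure ℝ := gammaMeasure cellShape (N.φb * cellShape)

/-- The probability that a cell has `n` users: given the cell size `s`, the number of users is
Poisson with mean `φ_u s`. -/
def cellUserProb (n : ℕ) : ℝ :=
  ∫ s, (poissonMeasure (N.φu * s).toNNReal).real {n} ∂N.cellSizeLaw

open Classical in
/-- `p_t`, the probability that a cell is full-load: its number `n` of users has `λ̄ τ n ≥ 1`. -/
def fullLoadProb : ℝ := ∑' n : ℕ, if 1 ≤ N.slotLoad n then N.cellUserProb n else 0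

open Classical in
/-- `p_0`, the probability that a cell is free-load: its number `n` of users has `λ̄ τ n < 1`,
and its queue, in equilibrium, is empty. -/
def freeLoadProb : ℝ :=
  ∑' n : ℕ, if N.slotLoad n < 1 then
    N.cellUserProb n * queueEmptyProb (N.slotLoad n).toNNReal else 0

/-- The retention probability `1 - p_0 + p_0 p_t` of the thinning that yields the active base
stations. -/
def activeProb : ℝ := 1 - N.freeLoadProb + N.freeLoadProb * N.fullLoadProb

/-- The intensity `φ_a = (1 - p_0 + p_0 p_t) φ_b` of the active base stations. -/
def φa : ℝ := N.activeProb * N.φb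

/-- The SINR threshold `T̄ = 2^(T / (τ B)) - 1`. -/
def threshold : ℝ := (2 : ℝ) ^ (N.T / (N.τ * N.B)) - 1

/-- `Z_1(t) = 2 t / (β - 2) * ₂F₁[1, 1 - 2/β; 2 - 2/β; -t]`. -/
def Z₁ (t : ℝ) : ℝ :=
  2 * t / (N.β - 2) *
    (gaussHypergeometric 1 ((1 - 2 / N.β : ℝ) : ℂ) ((2 - 2 / N.β : ℝ) : ℂ) ((-t : ℝ) : ℂ)).re

/-! The downlink of a user at the origin. Here `x k` is the position of the base station `k`,
`g k` its channel to the user, and `act k` tells whether it is active. -/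

/-- The serving base station: the nearest one (the least index, should there be a tie). -/
def serving (x : ℕ → Plane) : ℕ := sInf {k | ∀ j, ‖x k‖ ≤ ‖x j‖}

/-- The power `P |h_k|² d_k^(-β)` that the user receives from the base station `k`. -/
def receivedPower (x : ℕ → Plane) (g : ℕ → ℂ) (k : ℕ) : ℝ :=
  N.P * ‖g k‖ ^ 2 * ‖x k‖ ^ (-N.β)

/-- The power that the base station `k` contributes to the interference: the active base stations
other than the serving one interfere. -/
def interferenceTerm (x : ℕ → Plane) (g : ℕ → ℂ) (act : ℕ → Bool) (k : ℕ) : ℝ :=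
  if k ≠ serving x ∧ act k = true then N.receivedPower x g k else 0

/-- The signal-to-interference-plus-noise ratio of a cache-untenable user. -/
def sinr (x : ℕ → Plane) (g : ℕ → ℂ) (act : ℕ → Bool) : ℝ :=
  N.receivedPower x g (serving x) / ((∑' k, N.interferenceTerm x g act k) + N.σsq)

/-- The packet loss rate of a cache-untenable user: the probability that fewer than `T` bits get
through in a slot, `τ B log₂ (1 + SINR) < T`. -/
def packetLossRate {Ω : Type*} [MeasurableSpace Ω] (μ : Measure Ω)
    (X : ℕ → Ω → Plane) (h : ℕ → Ω → ℂ) (act : ℕ → Ω → Bool) : ℝ :=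
  μ.real {ω | N.τ * N.B *
    Real.logb 2 (1 + N.sinr (fun k => X k ω) (fun k => h k ω) (fun k => act k ω)) < N.T}

/-- The integrand of the packet loss formula. -/
def lossIntegrand (r : ℝ) : ℝ :=
  r * Real.exp (-(r ^ N.β * N.P⁻¹ * N.threshold * N.σsq)
    - Real.pi * r ^ 2 * (N.φa * N.Z₁ N.threshold + N.φb))

end CacheNetwork

end

/-!
Write `p` for the probability that a base station is active, `T̄` for the SINR threshold, and let
`κ t = T̄ t^(-β) / (1 + T̄ t^(-β))`. The event of success says that the power gain of the serving
station, an exponential variable, exceeds a level proportional to interference plus noise.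

*Given the positions.* By independence of the marks, the success probability for fixed positions is
the noise factor `exp (-T̄ d₀^β σ² / P)` times the product of `1 - p κ (d_k / d₀)` over all `k` other
than the serving station (`CacheNetwork.measure_threshold_le_sinr`; finitely many interferers at a
time, then a decreasing limit).

*Averaging over the positions.* Only the law of counts in Borel sets is given, so neither Palm
calculus nor a conditional law given `d₀` is at hand. What follows from the counts is the Laplace
functional `E exp (-∑ u (X k)) = exp (-φ ∫ (1 - exp (-u)))`
(`IsPoissonPointProcess.laplaceFunctional`), for measurable `u` with values in `[0, ∞]`. The value
`∞` on a disc encodes the event that the disc is empty; so the functional also shows that the event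
`a ≤ d₀ < b` is independent of the points outside the disc of radius `b`
(`IsPoissonPointProcess.setLIntegral_ring`). Round `d₀` up to a grid: on each cell of the grid the
product over the points beyond the upper end averages to a deterministic function of that end. As
the grid is refined, dominated convergence turns this into an identity between the averaged success
probability and an expectation of a function of `d₀` alone (`CacheNetwork.lintegral_success_eq`).
This uses that almost surely no two stations are equally far from the origin and that the path
losses are summable. The density of `d₀` comes from the void probabilities of discs.

*The coefficient `Z₁`.* In polar coordinates the exponent is `π r² φ_a * 2 ∫_1^∞ t κ t dt`. With
`z = -T̄`, the last integral is a multiple of `∫_1^∞ t^(1-β) / (1 - z t^(-β)) dt`, which is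
holomorphic off `[1, ∞)` and expands in the unit disc into the hypergeometric series; the identity
theorem identifies it with the continuation used in the statement (`CacheNetwork.Z₁_threshold_eq`).

*The thinning.* That `p` is nonnegative has to be proved, since the intensity `p φ_b` enters the
formula. The queue starts empty and grows stochastically, so `P(q_k = 0)` decreases in `k`; hence
its limit exists and lies in `[0, 1]` (`queueEmptyProb_mem_Icc`).
-/

noncomputable section

/-! ### The retention probability of the thinning -/

instance isProbabilityMeasure_queueLaw (a : NNReal) (k : ℕ) :
    IsProbabilityMeasure (queueLaw a k) := by
  induction k with
  | zero => rw [queueLaw]; infer_instance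
  | succ k ih =>
    rw [queueLaw]
    have := Measure.isProbabilityMeasure_map (μ := queueLaw a k) (f := fun q : ℕ => q - 1)
      Measurable.of_discrete.aemeasurable
    infer_instance

lemma lintegral_queueLaw_succ (a : NNReal) (k : ℕ) (f : ℕ → ENNReal) :
    ∫⁻ q, f q ∂(queueLaw a (k + 1)) =
      ∫⁻ q, ∫⁻ j, f (q - 1 + j) ∂(poissonMeasure a) ∂(queueLaw a k) := by
  rw [queueLaw, Measure.lintegral_conv .of_discrete, lintegral_map .of_discrete .of_discrete]

/-- Started from the empty buffer, the queue grows stochastically. -/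
lemma lintegral_queueLaw_succ_le (a : NNReal) (k : ℕ) {f : ℕ → ENNReal} (hf : Antitone f) :
    ∫⁻ q, f q ∂(queueLaw a (k + 1)) ≤ ∫⁻ q, f q ∂(queueLaw a k) := by
  induction k generalizing f with
  | zero =>
    calc ∫⁻ q, f q ∂(queueLaw a (0 + 1)) ≤ ∫⁻ _, f 0 ∂(queueLaw a (0 + 1)) :=
          lintegral_mono fun q => hf (Nat.zero_le q)
      _ = ∫⁻ q, f q ∂(queueLaw a 0) := by
          rw [lintegral_const, measure_univ, mul_one, queueLaw, lintegral_dirac]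
  | succ k ih =>
    rw [lintegral_queueLaw_succ a (k + 1) f, lintegral_queueLaw_succ a k f]
    exact ih fun q r hqr => lintegral_mono fun j => hf (by gcongr)

lemma antitone_queueLaw_zero (a : NNReal) : Antitone fun k => (queueLaw a k).real {0} := by
  refine antitone_nat_of_succ_le fun k => ?_
  refine ENNReal.toReal_mono (measure_ne_top _ _) ?_
  have hf : Antitone (Set.indicator {0} 1 : ℕ → ENNReal) := by
    intro q r hqr
    rcases Nat.eq_zero_or_pos r with rfl | hr
    · rw [Nat.le_zero.1 hqr]
    · rw [Set.indicator_of_notMem (by simpa using hr.ne')]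
      exact zero_le
  have := lintegral_queueLaw_succ_le a k hf
  rwa [lintegral_indicator_one (by measurability),
    lintegral_indicator_one (by measurability)] at this

lemma queueEmptyProb_mem_Icc (a : NNReal) : queueEmptyProb a ∈ Icc (0 : ℝ) 1 := by
  have hbdd : BddBelow (range fun k => (queueLaw a k).real {0}) :=
    ⟨0, by rintro _ ⟨k, rfl⟩; exact measureReal_nonneg⟩
  have h := tendsto_atTop_ciInf (antitone_queueLaw_zero a) hbdd
  rw [queueEmptyProb, h.limUnder_eq]
  exact isClosed_Icc.mem_of_tendsto h
    (Eventually.of_forall fun k => ⟨measureReal_nonneg, measureReal_le_one⟩)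

namespace CacheNetwork

variable (N : CacheNetwork)

lemma isProbabilityMeasure_cellSizeLaw : IsProbabilityMeasure N.cellSizeLaw :=
  isProbabilityMeasure_gammaMeasure (by norm_num [cellShape])
    (mul_pos N.φb_pos (by norm_num [cellShape]))

lemma cellUserProb_nonneg (n : ℕ) : 0 ≤ N.cellUserProb n :=
  integral_nonneg fun _ => measureReal_nonneg

lemma measurable_poissonMeasure_real_singleton (n : ℕ) :
    Measurable fun s => (poissonMeasure (N.φu * s).toNNReal).real {n} := by
  simp_rw [poissonMeasure_real_singleton]
  fun_prop

lemma sum_cellUserProb_le_one (F : Finset ℕ) : ∑ n ∈ F, N.cellUserProb n ≤ 1 := by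
  have := N.isProbabilityMeasure_cellSizeLaw
  have hint : ∀ n, Integrable (fun s => (poissonMeasure (N.φu * s).toNNReal).real {n})
      N.cellSizeLaw := fun n =>
    Integrable.of_bound (N.measurable_poissonMeasure_real_singleton n).aestronglyMeasurable 1
      (Eventually.of_forall fun s => by
        rw [Real.norm_of_nonneg measureReal_nonneg]; exact measureReal_le_one)
  simp only [cellUserProb]
  rw [← integral_finsetSum _ fun n _ => hint n]
  calc ∫ s, ∑ n ∈ F, (poissonMeasure (N.φu * s).toNNReal).real {n} ∂N.cellSizeLaw
      ≤ ∫ _, (1 : ℝ) ∂N.cellSizeLaw := by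
        refine integral_mono (integrable_finsetSum _ fun n _ => hint n) (integrable_const _)
          fun s => ?_
        simp only [sum_measureReal_singleton]
        exact measureReal_le_one
    _ = 1 := by simp

lemma fullLoadProb_nonneg : 0 ≤ N.fullLoadProb := by
  refine tsum_nonneg fun n => ?_
  split_ifs
  · exact N.cellUserProb_nonneg n
  · exact le_rfl

lemma freeLoadProb_nonneg : 0 ≤ N.freeLoadProb := by
  refine tsum_nonneg fun n => ?_
  split_ifs
  · exact mul_nonneg (N.cellUserProb_nonneg n) (queueEmptyProb_mem_Icc _).1
  · exact le_rfl

lemma freeLoadProb_le_one : N.freeLoadProb ≤ 1 := by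
  refine tsum_le_of_sum_le' zero_le_one fun F => ?_
  refine (Finset.sum_le_sum fun n _ => ?_).trans (N.sum_cellUserProb_le_one F)
  split_ifs
  · exact mul_le_of_le_one_right (N.cellUserProb_nonneg n) (queueEmptyProb_mem_Icc _).2
  · exact N.cellUserProb_nonneg n

lemma activeProb_nonneg : 0 ≤ N.activeProb := by
  have h1 := N.freeLoadProb_le_one
  have h2 := mul_nonneg N.freeLoadProb_nonneg N.fullLoadProb_nonneg
  rw [activeProb]
  linarith

lemma threshold_pos : 0 < N.threshold := by
  have := Real.one_lt_rpow (x := 2) one_lt_two (div_pos N.T_pos (mul_pos N.τ_pos N.B_pos))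
  rw [threshold]
  linarith

end CacheNetwork

/-! ### The hypergeometric function as an integral -/

lemma isOpen_slitDomain : IsOpen {z : ℂ | z.im ≠ 0 ∨ z.re < 1} :=
  (isOpen_ne_fun Complex.continuous_im continuous_const).union
    (isOpen_lt Complex.continuous_re continuous_const)

lemma isPreconnected_slitDomain : IsPreconnected {z : ℂ | z.im ≠ 0 ∨ z.re < 1} := by
  have h : StarConvex ℝ 0 {z : ℂ | z.im ≠ 0 ∨ z.re < 1} := by
    rw [starConvex_zero_iff]
    rintro z hz a ha0 ha1
    simp only [mem_ofPred_eq, Complex.smul_im, Complex.smul_re, smul_eq_mul] at hz ⊢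
    rcases ha0.eq_or_lt with rfl | ha
    · simp
    · rcases hz with hz | hz
      · exact Or.inl (mul_ne_zero ha.ne' hz)
      · right
        nlinarith
  exact (h.isPathConnected (Or.inr (by simp))).isConnected.isPreconnected

/-- The values of the Gauss hypergeometric function do not depend on the choice made in its
definition, by the identity theorem. -/
lemma gaussHypergeometric_eq {a b c : ℂ} {F : ℂ → ℂ} (hF : IsGaussHypergeometric a b c F) {z : ℂ}
    (hz : z.im ≠ 0 ∨ z.re < 1) : gaussHypergeometric a b c z = F z := by
  have hex : ∃ F, IsGaussHypergeometric a b c F := ⟨F, hF⟩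
  have hG := hex.choose_spec
  rw [gaussHypergeometric, dif_pos hex]
  refine (hG.1.analyticOnNhd isOpen_slitDomain).eqOn_of_preconnected_of_eventuallyEq
    (hF.1.analyticOnNhd isOpen_slitDomain) isPreconnected_slitDomain (z₀ := 0) (by simp) ?_ hz
  filter_upwards [Metric.ball_mem_nhds (0 : ℂ) one_pos] with w hw
  rw [mem_ball_zero_iff] at hw
  rw [hG.2 w hw, hF.2 w hw]

lemma one_sub_mul_ne_zero {z : ℂ} (hz : z.im ≠ 0 ∨ z.re < 1) {s : ℝ} (hs0 : 0 ≤ s) (hs1 : s ≤ 1) :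
    1 - z * s ≠ 0 := by
  intro h
  have hre := congrArg Complex.re h
  have him := congrArg Complex.im h
  simp at hre him
  rcases hz with hz | hz
  · rcases him with him | him
    · exact hz him
    · simp [him] at hre
  · rcases hs0.eq_or_lt with rfl | hs
    · simp at hre
    · nlinarith

/-- A holomorphic function given by integrating the Cauchy-type kernel `1 / (1 - z s(t))`
against an integrable weight, `s` taking values in `[0, 1]`. -/
lemma differentiableOn_integral_kernel {w s : ℝ → ℝ} {A : Set ℝ} (hA : MeasurableSet A)
    (hw : IntegrableOn w A) (hs : Measurable s) (hs01 : ∀ t ∈ A, s t ∈ Icc (0 : ℝ) 1) :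
    DifferentiableOn ℂ (fun z : ℂ => ∫ t in A, (w t : ℂ) / (1 - z * s t))
      {z : ℂ | z.im ≠ 0 ∨ z.re < 1} := by
  intro z₀ hz₀
  refine DifferentiableAt.differentiableWithinAt ?_
  obtain ⟨ε, hε, hball⟩ := Metric.nhds_basis_closedBall.mem_iff.1 (isOpen_slitDomain.mem_nhds hz₀)
  have hK : IsCompact (Metric.closedBall z₀ ε ×ˢ Icc (0 : ℝ) 1) :=
    (isCompact_closedBall z₀ ε).prod isCompact_Icc
  obtain ⟨⟨z₁, s₁⟩, h₁, hmin⟩ := hK.exists_isMinOn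
    ⟨(z₀, 0), Metric.mem_closedBall_self hε.le, by simp⟩
    (f := fun p : ℂ × ℝ => ‖1 - p.1 * p.2‖) (by fun_prop)
  set c := ‖1 - z₁ * s₁‖ with hc
  have hc0 : 0 < c := norm_pos_iff.2 (one_sub_mul_ne_zero (hball h₁.1) h₁.2.1 h₁.2.2)
  have hlow : ∀ z ∈ Metric.closedBall z₀ ε, ∀ t ∈ A, c ≤ ‖1 - z * s t‖ := fun z hz t ht =>
    hmin (show (z, s t) ∈ _ from ⟨hz, hs01 t ht⟩)
  have hwc : AEStronglyMeasurable (fun t => (w t : ℂ)) (volume.restrict A) :=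
    Complex.continuous_ofReal.comp_aestronglyMeasurable hw.aestronglyMeasurable
  have hm : ∀ z : ℂ, AEStronglyMeasurable (fun t => (w t : ℂ) / (1 - z * s t))
      (volume.restrict A) := fun z => by
    simp_rw [div_eq_mul_inv]
    exact hwc.mul (by fun_prop : Measurable fun t => (1 - z * (s t : ℂ))⁻¹).aestronglyMeasurable
  refine (hasDerivAt_integral_of_dominated_loc_of_deriv_le (𝕜 := ℂ)
    (F := fun z t => (w t : ℂ) / (1 - z * s t))
    (F' := fun z t => (w t : ℂ) * (s t / (1 - z * s t) ^ 2))
    (bound := fun t => |w t| * (1 / c ^ 2))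
    (Metric.closedBall_mem_nhds z₀ hε) (Eventually.of_forall hm) ?_ ?_ ?_ ?_ ?_).2.differentiableAt
  · refine Integrable.mono' (hw.norm.mul_const c⁻¹) (hm z₀) ?_
    filter_upwards [ae_restrict_mem hA] with t ht
    rw [norm_div, div_eq_mul_inv, Complex.norm_real]
    gcongr
    exact hlow z₀ (Metric.mem_closedBall_self hε.le) t ht
  · exact hwc.mul
      (by fun_prop : Measurable fun t => (s t : ℂ) / (1 - z₀ * (s t : ℂ)) ^ 2).aestronglyMeasurable
  · filter_upwards [ae_restrict_mem hA] with t ht z hz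
    rw [norm_mul, norm_div, Complex.norm_real, Complex.norm_real, norm_pow, Real.norm_eq_abs,
      Real.norm_of_nonneg (hs01 t ht).1]
    gcongr
    · exact (hs01 t ht).2
    · exact hlow z hz t ht
  · exact hw.norm.mul_const _
  · filter_upwards [ae_restrict_mem hA] with t ht z hz
    have hne := one_sub_mul_ne_zero (hball hz) (hs01 t ht).1 (hs01 t ht).2
    have h1 : HasDerivAt (fun z : ℂ => 1 - z * (s t : ℂ)) (-(s t : ℂ)) z := by
      simpa using ((hasDerivAt_id z).mul_const (s t : ℂ)).const_sub 1
    have := (hasDerivAt_const z (w t : ℂ)).div h1 hne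
    convert! this using 1
    field_simp
    ring

lemma ascPochhammer_eval_div (b : ℂ) (hb : 0 < b.re) (n : ℕ) :
    (ascPochhammer ℂ n).eval b * ((ascPochhammer ℂ n).eval (b + 1))⁻¹ = b / (b + n) := by
  have hpos : ∀ k : ℕ, b + k ≠ 0 := fun k h => by
    have := congrArg Complex.re h
    simp at this
    have := Nat.cast_nonneg (α := ℝ) k
    linarith
  induction n with
  | zero =>
    have := hpos 0
    simp at this
    simp [div_self this]
  | succ n ih =>
    rw [ascPochhammer_succ_eval, ascPochhammer_succ_eval, mul_inv, mul_mul_mul_comm, ih]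
    have h1 := hpos n
    have h2 := hpos (n + 1)
    push_cast at h2 ⊢
    have h3 : b + 1 + n ≠ 0 := by rwa [add_right_comm, add_assoc]
    field_simp
    ring

lemma ordinaryHypergeometric_one_add_one (b : ℂ) (hb : 0 < b.re) (z : ℂ) :
    ordinaryHypergeometric 1 b (b + 1) z = ∑' n : ℕ, b / (b + n) * z ^ n := by
  rw [ordinaryHypergeometric_eq_tsum]
  refine tsum_congr fun n => ?_
  rw [ascPochhammer_eval_one, mul_assoc, ascPochhammer_eval_div b hb, smul_eq_mul,
    inv_mul_cancel₀ (by exact_mod_cast n.factorial_ne_zero), one_mul]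

/-- Euler's integral for `₂F₁[1, 1 - 2/β; 2 - 2/β; z]`, in the variable `t = s ^ (-1/β)`. -/
lemma isGaussHypergeometric_integral {β : ℝ} (hβ : 2 < β) :
    IsGaussHypergeometric 1 ((1 - 2 / β : ℝ) : ℂ) ((2 - 2 / β : ℝ) : ℂ)
      (fun z => (β - 2) * ∫ t in Ioi (1 : ℝ), ((t ^ (1 - β) : ℝ) : ℂ) / (1 - z * (t ^ (-β) : ℝ))) := by
  have hs01 : ∀ t ∈ Ioi (1 : ℝ), t ^ (-β) ∈ Icc (0 : ℝ) 1 := fun t (ht : 1 < t) =>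
    ⟨Real.rpow_nonneg (by linarith) _, Real.rpow_le_one_of_one_le_of_nonpos ht.le (by linarith)⟩
  have hint : ∀ n : ℕ, IntegrableOn (fun t : ℝ => t ^ (1 - β - n * β)) (Ioi 1) := fun n =>
    integrableOn_Ioi_rpow_of_lt (by nlinarith [Nat.cast_nonneg (α := ℝ) n]) one_pos
  have hval : ∀ n : ℕ, ∫ t in Ioi (1 : ℝ), t ^ (1 - β - n * β) = 1 / (β - 2 + n * β) := fun n => by
    rw [integral_Ioi_rpow_of_lt (by nlinarith [Nat.cast_nonneg (α := ℝ) n]) one_pos,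
      Real.one_rpow, neg_div, ← div_neg]
    congr 1
    ring
  have hterm : ∀ (z : ℂ) (n : ℕ), ∀ t ∈ Ioi (1 : ℝ),
      ((t ^ (1 - β) : ℝ) : ℂ) * (z * (t ^ (-β) : ℝ)) ^ n
        = z ^ n * ((t ^ (1 - β - n * β) : ℝ) : ℂ) := fun z n t (ht : 1 < t) => by
    have ht0 : 0 < t := by linarith
    have : t ^ (1 - β - n * β) = t ^ (1 - β) * (t ^ (-β)) ^ n := by
      rw [← Real.rpow_natCast, ← Real.rpow_mul ht0.le, ← Real.rpow_add ht0]
      congr 1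
      ring
    rw [this, mul_pow]
    push_cast
    ring
  refine ⟨(differentiableOn_integral_kernel measurableSet_Ioi
    (by simpa using hint 0) (by fun_prop) hs01).const_mul _, fun z hz => ?_⟩
  have hbre : 0 < ((1 - 2 / β : ℝ) : ℂ).re := by
    rw [Complex.ofReal_re, sub_pos, div_lt_one (by linarith)]
    exact hβ
  have h2 : ((2 - 2 / β : ℝ) : ℂ) = ((1 - 2 / β : ℝ) : ℂ) + 1 := by
    push_cast
    ring
  rw [h2, ordinaryHypergeometric_one_add_one _ hbre]
  have hsum := hasSum_integral_of_summable_integral_norm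
    (μ := volume.restrict (Ioi (1 : ℝ)))
    (F := fun (n : ℕ) t => z ^ n * ((t ^ (1 - β - n * β) : ℝ) : ℂ))
    (fun n => ((hint n).ofReal).const_mul _) (by
      have : ∀ n : ℕ, ∫ t in Ioi (1 : ℝ), ‖z ^ n * ((t ^ (1 - β - n * β) : ℝ) : ℂ)‖
          = ‖z‖ ^ n * (1 / (β - 2 + n * β)) := fun n => by
        rw [← hval n, ← integral_const_mul]
        refine setIntegral_congr_fun measurableSet_Ioi fun t (ht : 1 < t) => ?_
        simp only [norm_mul, norm_pow, Complex.norm_real]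
        rw [Real.norm_of_nonneg (Real.rpow_nonneg (by linarith) _)]
      simp_rw [this]
      refine Summable.of_nonneg_of_le (fun n => ?_) (fun n => ?_)
        ((summable_geometric_of_lt_one (norm_nonneg z) hz).mul_right (1 / (β - 2)))
      · have : 0 < β - 2 + n * β := by nlinarith [Nat.cast_nonneg (α := ℝ) n]
        positivity
      · gcongr
        · exact le_add_of_nonneg_right (by positivity))
  have hlim : ∫ t in Ioi (1 : ℝ), ∑' n : ℕ, z ^ n * ((t ^ (1 - β - n * β) : ℝ) : ℂ)
      = ∫ t in Ioi (1 : ℝ), ((t ^ (1 - β) : ℝ) : ℂ) / (1 - z * (t ^ (-β) : ℝ)) := by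
    refine setIntegral_congr_fun measurableSet_Ioi fun t ht => ?_
    rw [tsum_congr fun n => (hterm z n t ht).symm, tsum_mul_left, tsum_geometric_of_norm_lt_one,
      div_eq_mul_inv]
    rw [norm_mul, Complex.norm_real, Real.norm_of_nonneg (hs01 t ht).1]
    exact (mul_le_of_le_one_right (norm_nonneg z) (hs01 t ht).2).trans_lt hz
  beta_reduce
  rw [← hlim, ← hsum.tsum_eq, ← tsum_mul_left]
  refine tsum_congr fun n => ?_
  rw [integral_const_mul, integral_complex_ofReal, hval n]
  have e1 : (β : ℂ) ≠ 0 := by exact_mod_cast (by linarith : β ≠ 0)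
  have e2 : ((β - 2 + n * β : ℝ) : ℂ) ≠ 0 := by
    exact_mod_cast (by nlinarith [Nat.cast_nonneg (α := ℝ) n] : 0 < β - 2 + n * β).ne'
  have e3 : ((1 - 2 / β : ℝ) : ℂ) + n = ((β - 2 + n * β : ℝ) : ℂ) / β := by
    push_cast
    field_simp
  rw [e3]
  push_cast at e2 ⊢
  field_simp

namespace CacheNetwork

variable (N : CacheNetwork)

/-- The chance, averaged over Rayleigh fading, that an interferer at `t` times the distance of the
serving station defeats the transmission: `1 - E exp (-T̄ t^(-β) |h|²)`. -/
def blocking (t : ℝ) : ℝ := N.threshold * t ^ (-N.β) / (1 + N.threshold * t ^ (-N.β))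

/-- The coefficient `Z₁` is the integral of the blocking probability over the exterior of the unit
disc, divided by `π`. -/
lemma Z₁_threshold_eq : N.Z₁ N.threshold = 2 * ∫ t in Ioi (1 : ℝ), t * N.blocking t := by
  have hβ := N.two_lt_β
  have hT := N.threshold_pos
  rw [Z₁, gaussHypergeometric_eq (isGaussHypergeometric_integral hβ)
    (Or.inr (by simpa using by linarith))]
  have h1 : ∫ t in Ioi (1 : ℝ), ((t ^ (1 - N.β) : ℝ) : ℂ) /
        (1 - ((-N.threshold : ℝ) : ℂ) * (t ^ (-N.β) : ℝ))
      = ((∫ t in Ioi (1 : ℝ), t ^ (1 - N.β) / (1 + N.threshold * t ^ (-N.β)) : ℝ) : ℂ) := by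
    rw [← integral_complex_ofReal]
    refine integral_congr_ae (Eventually.of_forall fun t => ?_)
    simp
  have h2 : ((N.β : ℂ) - 2) = ((N.β - 2 : ℝ) : ℂ) := by push_cast; rfl
  rw [h1, h2, ← Complex.ofReal_mul, Complex.ofReal_re]
  have h3 : ∫ t in Ioi (1 : ℝ), t * N.blocking t
      = N.threshold * ∫ t in Ioi (1 : ℝ), t ^ (1 - N.β) / (1 + N.threshold * t ^ (-N.β)) := by
    rw [← integral_const_mul]
    refine setIntegral_congr_fun measurableSet_Ioi fun t (ht : 1 < t) => ?_
    have ht0 : 0 < t := by linarith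
    simp only [blocking]
    rw [sub_eq_add_neg, Real.rpow_add ht0, Real.rpow_one]
    ring
  rw [h3]
  have : N.β - 2 ≠ 0 := by linarith
  field_simp

end CacheNetwork

/-! ### The function `exp (-s)` on `[0, ∞]` -/

/-- The function `s ↦ exp (-s)` on `[0, ∞]`, with value `0` at `∞`. -/
def expNeg (s : ENNReal) : ENNReal := (EReal.exp s)⁻¹

@[simp] lemma expNeg_zero : expNeg 0 = 1 := by simp [expNeg]

@[simp] lemma expNeg_top : expNeg ⊤ = 0 := by simp [expNeg]

lemma one_le_exp_coe (s : ENNReal) : 1 ≤ EReal.exp s :=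
  EReal.one_le_exp_iff.2 (EReal.coe_ennreal_nonneg s)

lemma expNeg_le_one (s : ENNReal) : expNeg s ≤ 1 := ENNReal.inv_le_one.2 (one_le_exp_coe s)

lemma expNeg_ne_top (s : ENNReal) : expNeg s ≠ ⊤ :=
  ((expNeg_le_one s).trans_lt ENNReal.one_lt_top).ne

lemma antitone_expNeg : Antitone expNeg := fun _ _ h =>
  ENNReal.inv_le_inv.2 (EReal.exp_monotone (EReal.coe_ennreal_le_coe_ennreal_iff.2 h))

lemma continuous_expNeg : Continuous expNeg :=
  continuous_inv.comp (ENNReal.continuous_exp.comp continuous_coe_ennreal_ereal)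

@[fun_prop] lemma measurable_expNeg : Measurable expNeg := continuous_expNeg.measurable

lemma expNeg_add (s t : ENNReal) : expNeg (s + t) = expNeg s * expNeg t := by
  rw [expNeg, EReal.coe_ennreal_add, EReal.exp_add,
    ENNReal.mul_inv (Or.inl (zero_lt_one.trans_le (one_le_exp_coe s)).ne')
      (Or.inr (zero_lt_one.trans_le (one_le_exp_coe t)).ne')]
  rfl

lemma expNeg_sum {ι : Type*} (F : Finset ι) (s : ι → ENNReal) :
    expNeg (∑ i ∈ F, s i) = ∏ i ∈ F, expNeg (s i) := by
  classical
  induction F using Finset.induction_on with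
  | empty => simp
  | insert a F ha ih => rw [Finset.sum_insert ha, Finset.prod_insert ha, expNeg_add, ih]

lemma expNeg_natCast_mul (n : ℕ) (s : ENNReal) : expNeg (s * n) = expNeg s ^ n := by
  have := expNeg_sum (Finset.range n) fun _ => s
  simpa [mul_comm] using this

lemma expNeg_ofReal {x : ℝ} (hx : 0 ≤ x) :
    expNeg (ENNReal.ofReal x) = ENNReal.ofReal (Real.exp (-x)) := by
  rw [expNeg, EReal.coe_ennreal_ofReal, max_eq_left hx, EReal.exp_coe, Real.exp_neg,
    ENNReal.ofReal_inv_of_pos (Real.exp_pos x)]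

lemma expNeg_eq {s : ENNReal} (hs : s ≠ ⊤) :
    expNeg s = ENNReal.ofReal (Real.exp (-s.toReal)) := by
  rw [← expNeg_ofReal ENNReal.toReal_nonneg, ENNReal.ofReal_toReal hs]

lemma one_sub_expNeg_le (s : ENNReal) : 1 - expNeg s ≤ s := by
  by_cases hs : s = ⊤
  · simp [hs]
  · rw [expNeg_eq hs, ← ENNReal.ofReal_one, ← ENNReal.ofReal_sub _ (Real.exp_pos _).le]
    refine ENNReal.ofReal_le_of_le_toReal ?_
    have := Real.add_one_le_exp (-s.toReal)
    linarith

/-! ### The Laplace functional of a Poisson point process -/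

/-- The moment generating function of the Poisson distribution. -/
lemma lintegral_expNeg_poissonMeasure (a : NNReal) (c : ENNReal) :
    ∫⁻ n : ℕ, expNeg (c * n) ∂(poissonMeasure a) = expNeg (a * (1 - expNeg c)) := by
  obtain ⟨q, hq⟩ : ∃ q : NNReal, (q : ENNReal) = expNeg c :=
    ⟨_, ENNReal.coe_toNNReal (expNeg_ne_top c)⟩
  have hq1 : q ≤ 1 := by
    have := expNeg_le_one c
    rw [← hq] at this
    exact_mod_cast this
  have h1 : ∀ n : ℕ, ENNReal.ofReal (Real.exp (-a) * a ^ n / n.factorial) * expNeg (c * n)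
      = ENNReal.ofReal (Real.exp (-(a * (1 - q : ℝ)))) *
        ENNReal.ofReal (Real.exp (-(a * q : NNReal)) * (a * q : NNReal) ^ n / n.factorial) :=
    fun n => by
    rw [expNeg_natCast_mul, ← hq, ← ENNReal.ofReal_coe_nnreal, ← ENNReal.ofReal_pow q.coe_nonneg,
      ← ENNReal.ofReal_mul (by positivity), ← ENNReal.ofReal_mul (by positivity)]
    congr 1
    have : Real.exp (-a) = Real.exp (-(a * (1 - q : ℝ))) * Real.exp (-(a * q)) := by
      rw [← Real.exp_add]
      congr 1
      ring
    rw [this]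
    push_cast
    ring
  rw [poissonMeasure, lintegral_sum_measure]
  simp_rw [lintegral_smul_measure, lintegral_dirac, smul_eq_mul, h1]
  rw [ENNReal.tsum_mul_left, ← ENNReal.ofReal_tsum_of_nonneg (fun n => by positivity)
    (hasSum_one_poissonMeasure (a * q)).summable, (hasSum_one_poissonMeasure (a * q)).tsum_eq,
    ENNReal.ofReal_one, mul_one, ← expNeg_ofReal (mul_nonneg a.coe_nonneg (sub_nonneg.2 (NNReal.coe_le_one.2 hq1))), ← hq,
    ENNReal.ofReal_mul a.coe_nonneg, ENNReal.ofReal_coe_nnreal, ENNReal.ofReal_sub _ q.coe_nonneg,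
    ENNReal.ofReal_one, ENNReal.ofReal_coe_nnreal]

lemma tsum_indicator_eq_pointCount {Ω : Type*} (X : ℕ → Ω → Plane) (A : Set Plane) (ω : Ω) :
    ∑' k, A.indicator (1 : Plane → ENNReal) (X k ω) = (pointCount X A ω : ENNReal) := by
  rw [pointCount, ← ENNReal.tsum_set_one, tsum_subtype {k | X k ω ∈ A} fun _ => (1 : ENNReal)]
  rfl

section PointProcess

variable {Ω : Type*} [MeasurableSpace Ω] {μ : Measure Ω} {X : ℕ → Ω → Plane} {φ : ℝ}

namespace IsPoissonPointProcess

variable (hX : IsPoissonPointProcess X φ μ)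
include hX

lemma measurable_pointCount {A : Set Plane} (hA : MeasurableSet A) :
    Measurable (pointCount X A) :=
  measurable_encard.comp (measurable_set_iff.2 fun k => (hX.measurable k hA).mem)

lemma ae_pointCount_ne_top [IsProbabilityMeasure μ] {A : Set Plane} (hA : MeasurableSet A)
    (hfin : volume A ≠ ⊤) : ∀ᵐ ω ∂μ, pointCount X A ω ≠ ⊤ := by
  have hm := hX.measurable_pointCount hA
  have hunion : {ω | pointCount X A ω ≠ ⊤} = ⋃ n : ℕ, {ω | pointCount X A ω = n} := by
    ext ω
    simp [ENat.ne_top_iff_exists, eq_comm]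
  have hmeas : ∀ n : ℕ, MeasurableSet {ω | pointCount X A ω = n} := fun n =>
    hm (measurableSet_singleton _)
  have h1 : μ {ω | pointCount X A ω ≠ ⊤} = 1 := by
    rw [hunion, measure_iUnion (fun i j hij => ?_) hmeas]
    · simp_rw [hX.count_law A hA hfin]
      rw [← measure_univ (μ := poissonMeasure (φ * volume.real A).toNNReal), ← iUnion_of_singleton ℕ,
        measure_iUnion (fun i j hij => by simpa using hij) (fun n => measurableSet_singleton n)]
    · refine disjoint_left.2 fun ω (hi : _ = _) (hj : _ = _) => hij ?_
      exact_mod_cast hi.symm.trans hj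
  exact (prob_compl_eq_zero_iff (hm (measurableSet_singleton _).compl)).2 h1

lemma lintegral_comp_pointCount [IsProbabilityMeasure μ] {A : Set Plane} (hA : MeasurableSet A)
    (hfin : volume A ≠ ⊤) (f : ℕ∞ → ENNReal) :
    ∫⁻ ω, f (pointCount X A ω) ∂μ
      = ∫⁻ n : ℕ, f n ∂(poissonMeasure (φ * volume.real A).toNNReal) := by
  have hm := hX.measurable_pointCount hA
  have hlaw : μ.map (pointCount X A)
      = (poissonMeasure (φ * volume.real A).toNNReal).map (fun n : ℕ => (n : ℕ∞)) := by
    refine Measure.ext_of_singleton fun n => ?_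
    rw [Measure.map_apply hm (measurableSet_singleton _),
      Measure.map_apply .of_discrete (measurableSet_singleton _)]
    induction n using ENat.recTopCoe with
    | top =>
      have h1 := hX.ae_pointCount_ne_top hA hfin
      rw [ae_iff] at h1
      simp only [ne_eq, not_not] at h1
      have h2 : (fun n : ℕ => (n : ℕ∞)) ⁻¹' {⊤} = ∅ := by ext; simp
      rw [h2, measure_empty]
      exact h1
    | coe n =>
      have h2 : (fun n : ℕ => (n : ℕ∞)) ⁻¹' {(n : ℕ∞)} = {n} := by ext; simp
      rw [h2]
      exact hX.count_law A hA hfin n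
  rw [← lintegral_map .of_discrete hm, hlaw, lintegral_map .of_discrete .of_discrete]

lemma lintegral_expNeg_sum_pointCount [IsProbabilityMeasure μ] (hφ : 0 ≤ φ) {m : ℕ}
    {A : Fin m → Set Plane}
    (hA : ∀ i, MeasurableSet (A i)) (hfin : ∀ i, volume (A i) ≠ ⊤)
    (hdisj : Pairwise fun i j => Disjoint (A i) (A j)) (c : Fin m → ENNReal) :
    ∫⁻ ω, expNeg (∑ i, c i * (pointCount X (A i) ω : ENNReal)) ∂μ
      = expNeg (ENNReal.ofReal φ * ∑ i, (1 - expNeg (c i)) * volume (A i)) := by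
  have hind := (hX.count_indep m A hA hfin hdisj).comp
    (fun i (n : ℕ∞) => expNeg (c i * (n : ENNReal))) fun i => .of_discrete
  simp_rw [expNeg_sum]
  rw [Finset.mul_sum, expNeg_sum]
  refine (lintegral_prod_eq_prod_lintegral_of_indepFun Finset.univ _ hind fun i =>
    Measurable.of_discrete.comp (hX.measurable_pointCount (hA i))).trans
    (Finset.prod_congr rfl fun i _ => ?_)
  simp only [Function.comp_apply]
  rw [hX.lintegral_comp_pointCount (hA i) (hfin i) fun n => expNeg (c i * (n : ENNReal))]
  have := lintegral_expNeg_poissonMeasure (φ * volume.real (A i)).toNNReal (c i)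
  simp only [ENat.toENNReal_coe]
  rw [this]
  congr 1
  have h2 : ((φ * volume.real (A i)).toNNReal : ENNReal) = ENNReal.ofReal φ * volume (A i) := by
    rw [← ENNReal.ofReal, ENNReal.ofReal_mul hφ, ofReal_measureReal (hfin i)]
  rw [h2]
  ring

lemma laplaceFunctional_simpleFunc [IsProbabilityMeasure μ] (hφ : 0 ≤ φ)
    (g : SimpleFunc Plane ENNReal) (hg : ∀ y ≠ 0, volume (g ⁻¹' {y}) ≠ ⊤) :
    ∫⁻ ω, expNeg (∑' k, g (X k ω)) ∂μ
      = expNeg (ENNReal.ofReal φ * ∫⁻ y, (1 - expNeg (g y))) := by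
  classical
  set S := g.range.filter (· ≠ 0) with hS
  set e := S.equivFin.symm with he
  have hsum : ∀ ω, ∑' k, g (X k ω)
      = ∑ i, (e i : ENNReal) * (pointCount X (g ⁻¹' {(e i : ENNReal)}) ω : ENNReal) := fun ω => by
    have hpt : ∀ y, g y = ∑ z ∈ S, z * (g ⁻¹' {z}).indicator 1 y := fun y => by
      by_cases hy : g y = 0
      · rw [hy, Finset.sum_eq_zero]
        intro z hz
        have hz0 : z ≠ 0 := (Finset.mem_filter.1 hz).2
        rw [Set.indicator_of_notMem, mul_zero]
        rw [mem_preimage, hy]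
        exact fun h => hz0 h.symm
      · rw [Finset.sum_eq_single (g y)]
        · simp
        · intro z _ hz
          rw [Set.indicator_of_notMem, mul_zero]
          exact fun h => hz h.symm
        · intro h
          exact absurd (Finset.mem_filter.2 ⟨g.mem_range_self y, hy⟩) h
    simp_rw [hpt (X _ ω)]
    rw [Summable.tsum_finsetSum fun _ _ => ENNReal.summable]
    simp_rw [ENNReal.tsum_mul_left, tsum_indicator_eq_pointCount]
    rw [← Finset.sum_coe_sort S fun z => z * (pointCount X (g ⁻¹' {z}) ω : ENNReal)]
    exact (Equiv.sum_comp e fun z : S => (z : ENNReal) *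
      (pointCount X (g ⁻¹' {(z : ENNReal)}) ω : ENNReal)).symm
  simp_rw [hsum]
  rw [hX.lintegral_expNeg_sum_pointCount hφ (fun i => g.measurableSet_preimage _)
    (fun i => hg _ (Finset.mem_filter.1 (e i).2).2) (fun i j hij => ?_)]
  · congr 2
    have h1 : ∫⁻ y, (1 - expNeg (g y)) = (g.map fun z => 1 - expNeg z).lintegral volume := by
      rw [← SimpleFunc.lintegral_eq_lintegral]
      rfl
    rw [h1, SimpleFunc.map_lintegral,
      Equiv.sum_comp e fun z : S => (1 - expNeg z) * volume (g ⁻¹' {(z : ENNReal)}),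
      Finset.sum_coe_sort S fun z => (1 - expNeg z) * volume (g ⁻¹' {z}), hS, Finset.sum_filter]
    refine Finset.sum_congr rfl fun z _ => ?_
    split_ifs with h
    · rfl
    · simp [not_not.1 h]
  · refine Disjoint.preimage _ ?_
    rw [disjoint_singleton]
    exact fun h => hij (e.injective (Subtype.ext h))

/-- The Laplace functional of the Poisson point process,
`E exp (-∑ u (X k)) = exp (-φ ∫ (1 - exp (-u)))`. The values of `u` may be infinite. -/
theorem laplaceFunctional [IsProbabilityMeasure μ] (hφ : 0 ≤ φ) {u : Plane → ENNReal}
    (hu : Measurable u) :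
    ∫⁻ ω, expNeg (∑' k, u (X k ω)) ∂μ
      = expNeg (ENNReal.ofReal φ * ∫⁻ y, (1 - expNeg (u y))) := by
  set g : ℕ → SimpleFunc Plane ENNReal := fun n =>
    (SimpleFunc.eapprox u n).restrict (Metric.ball 0 n) with hgdef
  have hgval : ∀ n y, g n y = (Metric.ball (0 : Plane) n).indicator (SimpleFunc.eapprox u n) y :=
    fun n y => SimpleFunc.restrict_apply _ measurableSet_ball y
  have hmono : ∀ y, Monotone fun n => g n y := fun y n m hnm => by
    simp only [hgval]
    refine (Set.indicator_le_indicator (SimpleFunc.monotone_eapprox u hnm y)).trans ?_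
    exact Set.indicator_le_indicator_of_subset
      (Metric.ball_subset_ball (by exact_mod_cast hnm)) (fun _ => zero_le) y
  have hlim : ∀ y, Tendsto (fun n => g n y) atTop (𝓝 (u y)) := fun y => by
    have h1 : Tendsto (fun n => SimpleFunc.eapprox u n y) atTop (𝓝 (u y)) := by
      rw [← SimpleFunc.iSup_eapprox_apply hu y]
      exact tendsto_atTop_iSup fun n m h => SimpleFunc.monotone_eapprox u h y
    refine h1.congr' ?_
    filter_upwards [eventually_gt_atTop ⌈‖y‖⌉₊] with n hn
    rw [hgval, Set.indicator_of_mem]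
    rw [mem_ball_zero_iff]
    exact (Nat.le_ceil _).trans_lt (by exact_mod_cast hn)
  have hsum : ∀ ω, Tendsto (fun n => ∑' k, g n (X k ω)) atTop (𝓝 (∑' k, u (X k ω))) := fun ω => by
    simp_rw [← lintegral_count]
    exact lintegral_tendsto_of_tendsto_of_monotone (fun n => Measurable.of_discrete.aemeasurable)
      (Eventually.of_forall fun k => hmono _) (Eventually.of_forall fun k => hlim _)
  have hleft : Tendsto (fun n => ∫⁻ ω, expNeg (∑' k, g n (X k ω)) ∂μ) atTop
      (𝓝 (∫⁻ ω, expNeg (∑' k, u (X k ω)) ∂μ)) := by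
    refine tendsto_lintegral_of_dominated_convergence (fun _ => 1) (fun n => ?_)
      (fun n => Eventually.of_forall fun ω => expNeg_le_one _) (by simp)
      (Eventually.of_forall fun ω => (continuous_expNeg.tendsto _).comp (hsum ω))
    exact measurable_expNeg.comp
      (Measurable.tsum fun k => (g n).measurable.comp (hX.measurable k))
  have hright : Tendsto (fun n => expNeg (ENNReal.ofReal φ * ∫⁻ y, (1 - expNeg (g n y)))) atTop
      (𝓝 (expNeg (ENNReal.ofReal φ * ∫⁻ y, (1 - expNeg (u y))))) := by
    refine (continuous_expNeg.tendsto _).comp (ENNReal.Tendsto.const_mul ?_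
      (Or.inr ENNReal.ofReal_ne_top))
    refine lintegral_tendsto_of_tendsto_of_monotone (fun n => ?_)
      (Eventually.of_forall fun y n m hnm => ?_) (Eventually.of_forall fun y => ?_)
    · exact (measurable_const.sub (measurable_expNeg.comp (g n).measurable)).aemeasurable
    · exact tsub_le_tsub_left (antitone_expNeg (hmono y hnm)) 1
    · exact ENNReal.Tendsto.sub tendsto_const_nhds ((continuous_expNeg.tendsto _).comp (hlim y))
        (Or.inl ENNReal.one_ne_top)
  refine tendsto_nhds_unique hleft (hright.congr fun n => ?_)
  refine (hX.laplaceFunctional_simpleFunc hφ (g n) fun y hy => ?_).symm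
  refine ((measure_mono fun x hx => ?_).trans_lt
    (measure_ball_lt_top (μ := volume) (x := (0 : Plane)) (r := (n : ℝ)))).ne
  by_contra hx'
  have : g n x = y := hx
  rw [hgval, Set.indicator_of_notMem hx'] at this
  exact hy this.symm

end IsPoissonPointProcess

end PointProcess

/-! ### Almost sure properties of the base stations -/

/-- The properties of the positions of the base stations that hold almost surely and on which the
downlink depends: finitely many stations in each disc, no two of them at the same distance from the
origin, none at the origin, and summable path losses. -/
structure IsRegularConfiguration (β : ℝ) (x : ℕ → Plane) : Prop where
  finite_le : ∀ r : ℝ, {k | ‖x k‖ ≤ r}.Finite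
  injective_norm : Function.Injective fun k => ‖x k‖
  norm_pos : ∀ k, 0 < ‖x k‖
  summable : Summable fun k => ‖x k‖ ^ (-β)

lemma IsRegularConfiguration.norm_serving_le {β : ℝ} {x : ℕ → Plane}
    (hx : IsRegularConfiguration β x) (j : ℕ) : ‖x (CacheNetwork.serving x)‖ ≤ ‖x j‖ := by
  have hne : {k | ∀ j, ‖x k‖ ≤ ‖x j‖}.Nonempty := by
    obtain ⟨k, hk, hmin⟩ := Set.exists_min_image _ (fun k => ‖x k‖) (hx.finite_le ‖x 0‖)
      ⟨0, le_refl ‖x 0‖⟩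
    refine ⟨k, fun j => ?_⟩
    rcases le_total ‖x j‖ ‖x 0‖ with h | h
    · exact hmin j h
    · exact le_trans hk h
  exact Nat.sInf_mem hne j

lemma IsRegularConfiguration.norm_serving_lt {β : ℝ} {x : ℕ → Plane}
    (hx : IsRegularConfiguration β x) {j : ℕ} (hj : j ≠ CacheNetwork.serving x) :
    ‖x (CacheNetwork.serving x)‖ < ‖x j‖ :=
  (hx.norm_serving_le j).lt_of_ne fun h => hj (hx.injective_norm h.symm)

lemma volume_real_ball_plane {r : ℝ} (hr : 0 ≤ r) :
    volume.real (Metric.ball (0 : Plane) r) = Real.pi * r ^ 2 := by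
  rw [measureReal_def, EuclideanSpace.volume_ball_fin_two, ← ENNReal.ofReal_pow hr,
    ← ENNReal.ofReal_mul (by positivity), ENNReal.toReal_ofReal (by positivity), mul_comm]

lemma lintegral_pathLoss_lt_top {β : ℝ} (hβ : 2 < β) :
    ∫⁻ y : Plane, {y | 1 ≤ ‖y‖}.indicator (fun y => ENNReal.ofReal (‖y‖ ^ (-β))) y < ⊤ := by
  have h := finite_integral_one_add_norm (E := Plane) (μ := volume) (r := β) (by simpa using hβ)
  refine lt_of_le_of_lt ?_ (ENNReal.mul_lt_top (ENNReal.ofReal_lt_top (r := 2 ^ β)) h)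
  rw [← lintegral_const_mul _ (by fun_prop)]
  refine lintegral_mono fun y => Set.indicator_apply_le' (fun hy => ?_) (fun _ => zero_le)
  have hy : 1 ≤ ‖y‖ := hy
  rw [← ENNReal.ofReal_mul (by positivity)]
  refine ENNReal.ofReal_le_ofReal ?_
  rw [Real.rpow_neg (by positivity), Real.rpow_neg (by positivity), ← div_eq_mul_inv,
    inv_eq_one_div, div_le_div_iff₀ (by positivity) (by positivity), one_mul,
    ← Real.mul_rpow (by norm_num) (by positivity)]
  exact Real.rpow_le_rpow (by positivity) (by linarith) (by linarith)

namespace IsPoissonPointProcess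

variable {Ω : Type*} [MeasurableSpace Ω] {μ : Measure Ω} {X : ℕ → Ω → Plane} {φ : ℝ}
  [IsProbabilityMeasure μ] (hX : IsPoissonPointProcess X φ μ)
include hX

lemma ae_finite_le : ∀ᵐ ω ∂μ, ∀ r : ℝ, {k | ‖X k ω‖ ≤ r}.Finite := by
  have h : ∀ᵐ ω ∂μ, ∀ n : ℕ, pointCount X (Metric.ball 0 n) ω ≠ ⊤ :=
    ae_all_iff.2 fun n => hX.ae_pointCount_ne_top measurableSet_ball measure_ball_lt_top.ne
  filter_upwards [h] with ω hω r
  obtain ⟨n, hn⟩ := exists_nat_gt r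
  refine (Set.encard_ne_top_iff.1 (hω n)).subset fun k (hk : ‖X k ω‖ ≤ r) => ?_
  exact mem_ball_zero_iff.2 (hk.trans_lt hn)

lemma ae_norm_pos : ∀ᵐ ω ∂μ, ∀ k, 0 < ‖X k ω‖ := by
  have h0 := hX.count_law {0} (measurableSet_singleton _) (by simp) 0
  have h1 : μ {ω | pointCount X {0} ω = (0 : ℕ)} = 1 := by
    rw [h0, poissonMeasure_singleton]
    simp [measureReal_def]
  have hm := hX.measurable_pointCount (measurableSet_singleton (0 : Plane))
    (measurableSet_singleton ((0 : ℕ) : ℕ∞))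
  have h2 : ∀ᵐ ω ∂μ, pointCount X {0} ω = (0 : ℕ) := (prob_compl_eq_zero_iff hm).2 h1
  filter_upwards [h2] with ω hω k
  refine norm_pos_iff.2 fun hk => ?_
  have : {k | X k ω ∈ ({0} : Set Plane)} = ∅ := Set.encard_eq_zero.1 hω
  exact (this ▸ (show k ∈ {k | X k ω ∈ ({0} : Set Plane)} from hk) : k ∈ (∅ : Set ℕ))

lemma measure_two_le_pointCount (hφ : 0 ≤ φ) {A : Set Plane} (hA : MeasurableSet A)
    (hfin : volume A ≠ ⊤) :
    μ {ω | 2 ≤ pointCount X A ω} ≤ ENNReal.ofReal ((φ * volume.real A) ^ 2) := by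
  set a := φ * volume.real A with ha
  have ha0 : 0 ≤ a := mul_nonneg hφ measureReal_nonneg
  have hm := hX.measurable_pointCount hA
  have hset : {ω | 2 ≤ pointCount X A ω}
      = ({ω | pointCount X A ω = (0 : ℕ)} ∪ {ω | pointCount X A ω = (1 : ℕ)})ᶜ := by
    ext ω
    simp only [mem_ofPred_eq, mem_compl_iff, mem_union]
    generalize pointCount X A ω = n
    induction n using ENat.recTopCoe with
    | top => simp
    | coe n => norm_cast; omega
  have hm' : ∀ n : ℕ, MeasurableSet {ω | pointCount X A ω = (n : ℕ∞)} := fun n =>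
    hm (measurableSet_singleton _)
  rw [hset, prob_compl_eq_one_sub ((hm' 0).union (hm' 1)), measure_union ?_ (hm' 1),
    hX.count_law A hA hfin, hX.count_law A hA hfin, poissonMeasure_singleton,
    poissonMeasure_singleton, Real.coe_toNNReal _ ha0, ← ENNReal.ofReal_add (by positivity)
    (by positivity), ← ENNReal.ofReal_one, ← ENNReal.ofReal_sub _ (by positivity)]
  · refine ENNReal.ofReal_le_ofReal ?_
    have := Real.add_one_le_exp (-a)
    simp
    nlinarith
  · refine disjoint_left.2 fun ω (h0 : _ = _) (h1 : _ = _) => ?_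
    have := h0.symm.trans h1
    norm_cast at this

/-- No two points lie at the same distance from the origin: cut a disc into `m` rings of equal
area; the probability that some ring has two points is of order `m * (1 / m) ^ 2`. -/
lemma ae_injective_norm (hφ : 0 ≤ φ) : ∀ᵐ ω ∂μ, Function.Injective fun k => ‖X k ω‖ := by
  have key : ∀ R : ℕ, ∀ᵐ ω ∂μ, ∀ j k, ‖X j ω‖ < R → ‖X j ω‖ = ‖X k ω‖ → j = k := fun R => by
    rw [ae_iff]
    set E := {ω | ¬∀ j k, ‖X j ω‖ < R → ‖X j ω‖ = ‖X k ω‖ → j = k} with hE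
    set c := (φ * (Real.pi * R ^ 2)) ^ 2 with hc
    have hbound : ∀ m : ℕ, μ E ≤ ENNReal.ofReal (c / ((m : ℝ) + 1)) := fun m => by
      have hm : (0 : ℝ) < (m : ℝ) + 1 := by positivity
      set r : ℕ → ℝ := fun i => R * √(i / ((m : ℝ) + 1)) with hr
      have hr0 : ∀ i, 0 ≤ r i := fun i => by positivity
      have hrsq : ∀ i, r i ^ 2 = R ^ 2 * (i / ((m : ℝ) + 1)) := fun i => by
        rw [hr, mul_pow, Real.sq_sqrt (by positivity)]
      have hrmono : ∀ i, r i ≤ r (i + 1) := fun i => by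
        simp only [hr]
        gcongr
        simp
      set A : ℕ → Set Plane := fun i => Metric.ball 0 (r (i + 1)) \ Metric.ball 0 (r i) with hA
      have hAm : ∀ i, MeasurableSet (A i) := fun i => measurableSet_ball.diff measurableSet_ball
      have hAfin : ∀ i, volume (A i) ≠ ⊤ := fun i =>
        ((measure_mono sdiff_subset).trans_lt measure_ball_lt_top).ne
      have hAvol : ∀ i, volume.real (A i) = Real.pi * R ^ 2 / ((m : ℝ) + 1) := fun i => by
        rw [measureReal_sdiff (Metric.ball_subset_ball (hrmono i)) measurableSet_ball
          measure_ball_lt_top.ne, volume_real_ball_plane (hr0 _),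
          volume_real_ball_plane (hr0 _), hrsq, hrsq]
        push_cast
        field_simp
        ring
      have hsub : E ⊆ ⋃ i ∈ Finset.range (m + 1), {ω | 2 ≤ pointCount X (A i) ω} := by
        intro ω hω
        simp only [hE, mem_ofPred_eq, not_forall] at hω
        obtain ⟨j, k, hjR, hjk, hne⟩ := hω
        have hR : (0 : ℝ) < R := (norm_nonneg _).trans_lt hjR
        have hex : ∃ i, ‖X j ω‖ < r (i + 1) := ⟨m, by
          simp only [hr]
          push_cast
          rwa [div_self hm.ne', Real.sqrt_one, mul_one]⟩
        classical
        set i := Nat.find hex with hi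
        have hi1 : ‖X j ω‖ < r (i + 1) := Nat.find_spec hex
        have him : i ≤ m := Nat.find_min' hex (by
          simp only [hr]
          push_cast
          rwa [div_self hm.ne', Real.sqrt_one, mul_one])
        have hi0 : r i ≤ ‖X j ω‖ := by
          rcases Nat.eq_zero_or_pos i with h | h
          · rw [h]
            simp [hr]
          · have := Nat.find_min hex (m := i - 1) (by omega)
            rw [Nat.sub_add_cancel h] at this
            exact not_lt.1 this
        have hmem : ∀ l, ‖X l ω‖ = ‖X j ω‖ → l ∈ {l | X l ω ∈ A i} := fun l hl => by
          refine ⟨mem_ball_zero_iff.2 (by rwa [hl]), fun h => ?_⟩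
          rw [mem_ball_zero_iff, hl] at h
          exact absurd hi0 (not_le.2 h)
        simp only [mem_iUnion]
        refine ⟨i, Finset.mem_range.2 (by omega), ?_⟩
        change 2 ≤ Set.encard _
        rw [← Set.encard_pair hne]
        exact Set.encard_le_encard (by
          rintro l (rfl | rfl)
          · exact hmem _ rfl
          · exact hmem _ hjk.symm)
      calc μ E ≤ ∑ i ∈ Finset.range (m + 1), μ {ω | 2 ≤ pointCount X (A i) ω} :=
            (measure_mono hsub).trans (measure_biUnion_finset_le _ _)
        _ ≤ ∑ i ∈ Finset.range (m + 1),
              ENNReal.ofReal ((φ * (Real.pi * R ^ 2 / ((m : ℝ) + 1))) ^ 2) := by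
            refine Finset.sum_le_sum fun i _ => ?_
            rw [← hAvol i]
            exact hX.measure_two_le_pointCount hφ (hAm i) (hAfin i)
        _ = ENNReal.ofReal (c / ((m : ℝ) + 1)) := by
            rw [Finset.sum_const, Finset.card_range, ← ENNReal.ofReal_nsmul]
            congr 1
            rw [hc, nsmul_eq_mul]
            push_cast
            field_simp
    have hlim : Tendsto (fun m : ℕ => ENNReal.ofReal (c / ((m : ℝ) + 1))) atTop (𝓝 0) := by
      rw [← ENNReal.ofReal_zero]
      refine ENNReal.tendsto_ofReal ?_
      simpa [div_eq_mul_inv] using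
        (tendsto_one_div_add_atTop_nhds_zero_nat (𝕜 := ℝ)).const_mul c
    exact le_antisymm (ge_of_tendsto' hlim hbound) zero_le
  filter_upwards [ae_all_iff.2 key] with ω hω j k hjk
  obtain ⟨R, hR⟩ := exists_nat_gt ‖X j ω‖
  exact hω R j k hR hjk

/-- If `u` is integrable then `∑ u (X k)` is finite: `P (∑ u (X k) < ∞)` is at least
`E exp (-∑ u (X k) / m) ≥ exp (-φ ∫ u / m)` for each `m`. -/
lemma ae_tsum_ne_top (hφ : 0 ≤ φ) {u : Plane → ENNReal} (hu : Measurable u)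
    (hfin : ∫⁻ y, u y ≠ ⊤) : ∀ᵐ ω ∂μ, ∑' k, u (X k ω) ≠ ⊤ := by
  have hm : Measurable fun ω => ∑' k, u (X k ω) :=
    Measurable.tsum fun k => hu.comp (hX.measurable k)
  set E := {ω | ∑' k, u (X k ω) ≠ ⊤} with hE
  have hEm : MeasurableSet E := hm (measurableSet_singleton _).compl
  set J := ENNReal.ofReal φ * ∫⁻ y, u y with hJ
  have hJfin : J ≠ ⊤ := ENNReal.mul_ne_top ENNReal.ofReal_ne_top hfin
  have hbound : ∀ m : ℕ, expNeg (((m : ENNReal) + 1)⁻¹ * J) ≤ μ E := fun m => by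
    set t : ENNReal := ((m : ENNReal) + 1)⁻¹ with ht
    have ht0 : t ≠ 0 := ENNReal.inv_ne_zero.2 (by finiteness)
    calc expNeg (t * J)
        ≤ expNeg (ENNReal.ofReal φ * ∫⁻ y, (1 - expNeg (t * u y))) := by
          refine antitone_expNeg ?_
          rw [hJ, mul_left_comm, ← lintegral_const_mul _ hu]
          gcongr
          exact one_sub_expNeg_le _
      _ = ∫⁻ ω, expNeg (∑' k, t * u (X k ω)) ∂μ :=
          (hX.laplaceFunctional hφ (hu.const_mul t)).symm
      _ ≤ ∫⁻ ω, E.indicator 1 ω ∂μ := by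
          refine lintegral_mono fun ω => ?_
          by_cases hω : ω ∈ E
          · rw [Set.indicator_of_mem hω]
            exact expNeg_le_one _
          · have : ∑' k, u (X k ω) = ⊤ := by simpa [hE] using hω
            rw [ENNReal.tsum_mul_left, this, ENNReal.mul_top ht0, expNeg_top]
            exact zero_le
      _ = μ E := lintegral_indicator_one hEm
  have hlim : Tendsto (fun m : ℕ => expNeg (((m : ENNReal) + 1)⁻¹ * J)) atTop (𝓝 1) := by
    rw [← expNeg_zero, ← zero_mul J]
    refine (continuous_expNeg.tendsto _).comp (ENNReal.Tendsto.mul_const ?_ (Or.inr hJfin))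
    have := (tendsto_add_atTop_iff_nat 1).2 ENNReal.tendsto_inv_nat_nhds_zero
    simpa using this
  exact (prob_compl_eq_zero_iff hEm).2 (le_antisymm prob_le_one (le_of_tendsto' hlim hbound))

lemma ae_summable_pathLoss (hφ : 0 ≤ φ) {β : ℝ} (hβ : 2 < β) :
    ∀ᵐ ω ∂μ, Summable fun k => ‖X k ω‖ ^ (-β) := by
  have hmeas : Measurable
      ({y : Plane | 1 ≤ ‖y‖}.indicator fun y => ENNReal.ofReal (‖y‖ ^ (-β))) :=
    (by fun_prop : Measurable fun y : Plane => ENNReal.ofReal (‖y‖ ^ (-β))).indicator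
      (measurableSet_le measurable_const measurable_norm)
  filter_upwards [hX.ae_tsum_ne_top hφ hmeas (lintegral_pathLoss_lt_top hβ).ne,
    hX.ae_finite_le] with ω hω hfin
  have hs : Summable fun k => {y : Plane | 1 ≤ ‖y‖}.indicator (fun y => ‖y‖ ^ (-β)) (X k ω) := by
    refine (ENNReal.summable_toReal hω).congr fun k => ?_
    by_cases hk : X k ω ∈ {y : Plane | 1 ≤ ‖y‖}
    · rw [Set.indicator_of_mem hk, Set.indicator_of_mem hk, ENNReal.toReal_ofReal (by positivity)]
    · rw [Set.indicator_of_notMem hk, Set.indicator_of_notMem hk, ENNReal.toReal_zero]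
  refine (summable_congr_cofinite ?_).1 hs
  rw [EventuallyEq, eventually_cofinite]
  refine (hfin 1).subset fun k hk => ?_
  by_contra hk'
  have hle : ¬‖X k ω‖ ≤ 1 := hk'
  have hmem : X k ω ∈ {y : Plane | 1 ≤ ‖y‖} := by
    rw [mem_ofPred_eq]
    exact (not_le.1 hle).le
  exact hk (Set.indicator_of_mem hmem _)

lemma ae_isRegularConfiguration (hφ : 0 ≤ φ) {β : ℝ} (hβ : 2 < β) :
    ∀ᵐ ω ∂μ, IsRegularConfiguration β fun k => X k ω := by
  filter_upwards [hX.ae_finite_le, hX.ae_injective_norm hφ, hX.ae_norm_pos,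
    hX.ae_summable_pathLoss hφ hβ] with ω h1 h2 h3 h4
  exact ⟨h1, h2, h3, h4⟩

end IsPoissonPointProcess

/-! ### Rayleigh fading -/

lemma expMeasure_Ici {z : ℝ} (hz : 0 ≤ z) :
    expMeasure 1 (Ici z) = ENNReal.ofReal (Real.exp (-z)) := by
  have := isProbabilityMeasure_expMeasure one_pos
  have h1 : expMeasure 1 {z} = 0 :=
    withDensity_absolutelyContinuous volume _ (Real.volume_singleton)
  have h2 : expMeasure 1 (Ici z) = expMeasure 1 (Ioi z) := by
    rw [← Icc_union_Ioi_eq_Ici (le_refl z), Icc_self, measure_union (by simp) measurableSet_Ioi, h1,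
      zero_add]
  have h3 := cdf_expMeasure_eq one_pos z
  rw [cdf_eq_real, if_pos hz, one_mul] at h3
  rw [h2, ← compl_Iic, prob_compl_eq_one_sub measurableSet_Iic,
    ← ofReal_measureReal (measure_ne_top _ _), h3, ← ENNReal.ofReal_one, ← ENNReal.ofReal_sub]
  · congr 1
    ring
  · rw [sub_nonneg, Real.exp_le_one_iff]
    linarith

lemma measurable_exponentialPDF (r : ℝ) : Measurable (exponentialPDF r) :=
  (measurable_exponentialPDFReal r).ennreal_ofReal

lemma lintegral_expMeasure (r : ℝ) {f : ℝ → ENNReal} (hf : Measurable f) :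
    ∫⁻ y, f y ∂(expMeasure r) = ∫⁻ y, exponentialPDF r y * f y :=
  lintegral_withDensity_eq_lintegral_mul _ (measurable_exponentialPDF r) hf

lemma lintegral_exp_neg_expMeasure {c : ℝ} (hc : 0 ≤ c) :
    ∫⁻ y, ENNReal.ofReal (Real.exp (-(c * y))) ∂(expMeasure 1) = ENNReal.ofReal (1 / (1 + c)) := by
  have hc1 : 0 < 1 + c := by linarith
  have h : ∀ y, exponentialPDF 1 y * ENNReal.ofReal (Real.exp (-(c * y)))
      = ENNReal.ofReal (1 / (1 + c)) * exponentialPDF (1 + c) y := fun y => by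
    rw [exponentialPDF_eq, exponentialPDF_eq]
    split_ifs
    · rw [← ENNReal.ofReal_mul (by positivity), ← ENNReal.ofReal_mul (by positivity), ← mul_assoc,
        one_div_mul_cancel hc1.ne', one_mul, one_mul, one_mul, ← Real.exp_add]
      congr 2
      ring
    · simp
  rw [lintegral_expMeasure 1 (by fun_prop)]
  simp_rw [h]
  rw [lintegral_const_mul _ (measurable_exponentialPDF _),
    lintegral_exponentialPDF_eq_one hc1, mul_one]

lemma lintegral_id_expMeasure_ne_top : ∫⁻ y, ENNReal.ofReal y ∂(expMeasure 1) ≠ ⊤ := by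
  have h : ∀ y, exponentialPDF 1 y * ENNReal.ofReal y
      ≤ ENNReal.ofReal 4 * exponentialPDF (1 / 2) y := fun y => by
    rw [exponentialPDF_eq, exponentialPDF_eq]
    split_ifs with hy
    · rw [← ENNReal.ofReal_mul (by positivity), ← ENNReal.ofReal_mul (by positivity)]
      refine ENNReal.ofReal_le_ofReal ?_
      have h1 : Real.exp (-(1 * y)) = Real.exp (-(1 / 2 * y)) * Real.exp (-(1 / 2 * y)) := by
        rw [← Real.exp_add]
        congr 1
        ring
      have h2 : y ≤ 2 * Real.exp (1 / 2 * y) := by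
        have := Real.add_one_le_exp (1 / 2 * y)
        linarith
      have h3 : Real.exp (-(1 / 2 * y)) * Real.exp (1 / 2 * y) = 1 := by
        rw [← Real.exp_add]
        simp
      have h4 := Real.exp_pos (-(1 / 2 * y))
      calc 1 * Real.exp (-(1 * y)) * y
          ≤ 1 * Real.exp (-(1 * y)) * (2 * Real.exp (1 / 2 * y)) := by gcongr
        _ = 2 * Real.exp (-(1 / 2 * y)) * (Real.exp (-(1 / 2 * y)) * Real.exp (1 / 2 * y)) := by
            rw [h1]
            ring
        _ = 4 * (1 / 2 * Real.exp (-(1 / 2 * y))) := by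
            rw [h3]
            ring
    · simp
  rw [lintegral_expMeasure 1 (by fun_prop)]
  refine ((lintegral_mono h).trans_lt ?_).ne
  rw [lintegral_const_mul _ (measurable_exponentialPDF _),
    lintegral_exponentialPDF_eq_one (by norm_num), mul_one]
  exact ENNReal.ofReal_lt_top

section Fading

variable {Ω : Type*} [MeasurableSpace Ω] {μ : Measure Ω} [IsProbabilityMeasure μ]

/-- An exponential variable exceeds an independent nonnegative level `Z` with probability
`E exp (-Z)`. -/
lemma measure_le_of_hasLaw_expMeasure {Y Z : Ω → ℝ} (hY : HasLaw Y (expMeasure 1) μ)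
    (hYm : Measurable Y) (hZm : Measurable Z) (hind : IndepFun Z Y μ) (hZ : ∀ ω, 0 ≤ Z ω) :
    μ {ω | Z ω ≤ Y ω} = ∫⁻ ω, ENNReal.ofReal (Real.exp (-Z ω)) ∂μ := by
  have := isProbabilityMeasure_expMeasure one_pos
  have hS : MeasurableSet {p : ℝ × ℝ | p.1 ≤ p.2} := measurableSet_le measurable_fst measurable_snd
  have hmap := (indepFun_iff_map_prod_eq_prod_map_map hZm.aemeasurable hYm.aemeasurable).1 hind
  rw [hY.map_eq] at hmap
  have h1 : μ {ω | Z ω ≤ Y ω} = μ.map (fun ω => (Z ω, Y ω)) {p : ℝ × ℝ | p.1 ≤ p.2} :=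
    (Measure.map_apply (hZm.prodMk hYm) hS).symm
  rw [h1, hmap, Measure.prod_apply hS, lintegral_map (measurable_measure_prodMk_left hS) hZm]
  exact lintegral_congr fun ω => expMeasure_Ici (hZ ω)

/-- The Laplace transform of a Rayleigh fading power gain that is switched on with
probability `p`. -/
lemma lintegral_exp_neg_mark {a : Ω → Bool} {g : Ω → ℂ} {p : ℝ} (hp0 : 0 ≤ p) (hp1 : p ≤ 1)
    (ha : Measurable a) (hg : Measurable g) (hlaw : HasLaw (fun ω => ‖g ω‖ ^ 2) (expMeasure 1) μ)
    (hap : μ {ω | a ω = true} = ENNReal.ofReal p) (hind : IndepFun a g μ) {c : ℝ} (hc : 0 ≤ c) :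
    ∫⁻ ω, ENNReal.ofReal (Real.exp (-(if a ω = true then c * ‖g ω‖ ^ 2 else 0))) ∂μ
      = ENNReal.ofReal (1 - p * (c / (1 + c))) := by
  have hS : MeasurableSet {ω | a ω = true} := ha (measurableSet_singleton true)
  have hG : Measurable fun ω => ENNReal.ofReal (Real.exp (-(c * ‖g ω‖ ^ 2))) := by fun_prop
  have hpt : ∀ ω, ENNReal.ofReal (Real.exp (-(if a ω = true then c * ‖g ω‖ ^ 2 else 0)))
      = {ω | a ω = true}ᶜ.indicator 1 ω
        + {ω | a ω = true}.indicator 1 ω * ENNReal.ofReal (Real.exp (-(c * ‖g ω‖ ^ 2))) := fun ω => by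
    by_cases h : a ω = true <;> simp [h]
  simp_rw [hpt]
  have hmul : ∫⁻ ω, {ω | a ω = true}.indicator 1 ω * ENNReal.ofReal (Real.exp (-(c * ‖g ω‖ ^ 2))) ∂μ
      = (∫⁻ ω, {ω | a ω = true}.indicator 1 ω ∂μ)
        * ∫⁻ ω, ENNReal.ofReal (Real.exp (-(c * ‖g ω‖ ^ 2))) ∂μ :=
    lintegral_mul_eq_lintegral_mul_lintegral_of_indepFun (measurable_one.indicator hS) hG
      (hind.comp (φ := ({true} : Set Bool).indicator (1 : Bool → ENNReal))
        (ψ := fun z : ℂ => ENNReal.ofReal (Real.exp (-(c * ‖z‖ ^ 2)))) .of_discrete (by fun_prop))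
  have hexp : ∫⁻ ω, ENNReal.ofReal (Real.exp (-(c * ‖g ω‖ ^ 2))) ∂μ
      = ENNReal.ofReal (1 / (1 + c)) := by
    rw [← lintegral_exp_neg_expMeasure hc, ← hlaw.map_eq, lintegral_map (by fun_prop) (by fun_prop)]
  rw [lintegral_add_left (measurable_one.indicator hS.compl), hmul, hexp,
    lintegral_indicator_one hS.compl, lintegral_indicator_one hS, prob_compl_eq_one_sub hS, hap,
    ← ENNReal.ofReal_one, ← ENNReal.ofReal_sub _ hp0, ← ENNReal.ofReal_mul hp0,
    ← ENNReal.ofReal_add (by linarith) (by positivity)]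
  congr 1
  have : 1 + c ≠ 0 := by linarith
  field_simp
  ring

end Fading

namespace CacheNetwork

variable (N : CacheNetwork)

/-! ### The downlink for given positions of the base stations -/

lemma blocking_nonneg {t : ℝ} (ht : 0 ≤ t) : 0 ≤ N.blocking t := by
  have := N.threshold_pos
  rw [blocking]
  positivity

lemma blocking_lt_one {t : ℝ} (ht : 0 ≤ t) : N.blocking t < 1 := by
  have := N.threshold_pos
  have : 0 ≤ N.threshold * t ^ (-N.β) := by positivity
  rw [blocking, div_lt_one (by linarith)]
  linarith

/-- The contribution to `-log P(success | positions)` of a possible interferer at `t` times the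
distance of the serving station. -/
def lossExponent (t : ℝ) : ℝ := -Real.log (1 - N.activeProb * N.blocking t)

section

variable (hp1 : N.activeProb ≤ 1) {t : ℝ} (ht : 0 ≤ t)
include hp1 ht

lemma one_sub_blocking_pos : 0 < 1 - N.activeProb * N.blocking t := by
  have h1 := N.blocking_nonneg ht
  have h2 := N.blocking_lt_one ht
  have h3 := N.activeProb_nonneg
  nlinarith

lemma lossExponent_nonneg : 0 ≤ N.lossExponent t := by
  have := mul_nonneg N.activeProb_nonneg (N.blocking_nonneg ht)
  exact neg_nonneg.2 (Real.log_nonpos (N.one_sub_blocking_pos hp1 ht).le (by linarith))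

lemma expNeg_lossExponent :
    expNeg (ENNReal.ofReal (N.lossExponent t))
      = ENNReal.ofReal (1 - N.activeProb * N.blocking t) := by
  rw [expNeg_ofReal (N.lossExponent_nonneg hp1 ht), lossExponent, neg_neg,
    Real.exp_log (N.one_sub_blocking_pos hp1 ht)]

lemma lossExponent_le : N.lossExponent t ≤ N.threshold * t ^ (-N.β) := by
  have hy : 0 ≤ N.threshold * t ^ (-N.β) := by
    have := N.threshold_pos
    positivity
  have h1 : 1 / (1 + N.threshold * t ^ (-N.β)) ≤ 1 - N.activeProb * N.blocking t := by
    have h2 : 1 / (1 + N.threshold * t ^ (-N.β)) = 1 - N.blocking t := by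
      rw [blocking]
      field_simp
      ring
    have := N.blocking_nonneg ht
    rw [h2]
    nlinarith
  have h3 := Real.log_le_log (by positivity) h1
  rw [one_div, Real.log_inv] at h3
  have h4 := Real.log_le_sub_one_of_pos (x := 1 + N.threshold * t ^ (-N.β)) (by positivity)
  rw [lossExponent]
  linarith

end

lemma receivedPower_nonneg (x : ℕ → Plane) (g : ℕ → ℂ) (k : ℕ) : 0 ≤ N.receivedPower x g k := by
  have := N.P_pos
  rw [receivedPower]
  positivity

lemma interferenceTerm_nonneg (x : ℕ → Plane) (g : ℕ → ℂ) (act : ℕ → Bool) (k : ℕ) :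
    0 ≤ N.interferenceTerm x g act k := by
  rw [interferenceTerm]
  split_ifs
  · exact N.receivedPower_nonneg x g k
  · exact le_rfl

/-- The factor that turns an interference power into a level for the power gain of a serving
station at distance `d`. -/
def gainScale (d : ℝ) : ℝ := N.threshold * d ^ N.β / N.P

lemma gainScale_pos {d : ℝ} (hd : 0 < d) : 0 < N.gainScale d := by
  have := N.threshold_pos
  have := N.P_pos
  rw [gainScale]
  positivity

lemma threshold_le_sinr_iff {x : ℕ → Plane} (hx : 0 < ‖x (serving x)‖) (g : ℕ → ℂ)
    (act : ℕ → Bool) :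
    N.threshold ≤ N.sinr x g act ↔
      N.gainScale ‖x (serving x)‖ * ((∑' k, N.interferenceTerm x g act k) + N.σsq)
        ≤ ‖g (serving x)‖ ^ 2 := by
  have hP := N.P_pos
  have hI : 0 < (∑' k, N.interferenceTerm x g act k) + N.σsq :=
    add_pos_of_nonneg_of_pos (tsum_nonneg fun k => N.interferenceTerm_nonneg x g act k) N.σsq_pos
  have hd := Real.rpow_pos_of_pos hx N.β
  rw [sinr, le_div_iff₀ hI, receivedPower, gainScale, Real.rpow_neg hx.le, div_mul_eq_mul_div,
    div_le_iff₀ hP, ← div_eq_mul_inv, le_div_iff₀ hd]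
  constructor <;> intro h <;> linarith

section Downlink

variable {Ω : Type*} [MeasurableSpace Ω] {μ : Measure Ω} {h : ℕ → Ω → ℂ} {act : ℕ → Ω → Bool}

lemma ae_summable_interferenceTerm (h_meas : ∀ k, Measurable (h k))
    (h_law : ∀ k, HasLaw (fun ω => ‖h k ω‖ ^ 2) (expMeasure 1) μ) {x : ℕ → Plane}
    (hx : IsRegularConfiguration N.β x) :
    ∀ᵐ ω ∂μ, Summable (N.interferenceTerm x (fun k => h k ω) (fun k => act k ω)) := by
  have hP := N.P_pos
  have hrec : ∀ᵐ ω ∂μ, ∑' k, ENNReal.ofReal (N.receivedPower x (fun k => h k ω) k) ≠ ⊤ := by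
    have hm : ∀ k, Measurable fun ω => ENNReal.ofReal (N.receivedPower x (fun k => h k ω) k) :=
      fun k => by
        have := h_meas k
        simp only [receivedPower]
        fun_prop
    refine (ae_lt_top (Measurable.tsum hm) ?_).mono fun ω hω => hω.ne
    rw [lintegral_tsum fun k => (hm k).aemeasurable]
    have hk : ∀ k, ∫⁻ ω, ENNReal.ofReal (N.receivedPower x (fun k => h k ω) k) ∂μ
        = ENNReal.ofReal (‖x k‖ ^ (-N.β))
          * (ENNReal.ofReal N.P * ∫⁻ y, ENNReal.ofReal y ∂(expMeasure 1)) := fun k => by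
      have hhk := h_meas k
      rw [← (h_law k).map_eq, lintegral_map (by fun_prop) (by fun_prop),
        ← lintegral_const_mul _ (by fun_prop), ← lintegral_const_mul _ (by fun_prop)]
      refine lintegral_congr fun ω => ?_
      rw [receivedPower, ← ENNReal.ofReal_mul hP.le, ← ENNReal.ofReal_mul (by positivity)]
      congr 1
      ring
    simp_rw [hk]
    rw [ENNReal.tsum_mul_right]
    exact ENNReal.mul_ne_top hx.summable.tsum_ofReal_ne_top
      (ENNReal.mul_ne_top ENNReal.ofReal_ne_top lintegral_id_expMeasure_ne_top)
  filter_upwards [hrec] with ω hω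
  refine Summable.of_nonneg_of_le (N.interferenceTerm_nonneg _ _ _) (fun k => ?_)
    (ENNReal.summable_toReal hω)
  rw [ENNReal.toReal_ofReal (N.receivedPower_nonneg _ _ _), interferenceTerm]
  split_ifs
  · exact le_rfl
  · exact N.receivedPower_nonneg _ _ _

/-- The probability of success for given positions `x` of the base stations. -/
theorem measure_threshold_le_sinr [IsProbabilityMeasure μ] (hp1 : N.activeProb ≤ 1) (h_meas : ∀ k, Measurable (h k))
    (h_law : ∀ k, HasLaw (fun ω => ‖h k ω‖ ^ 2) (expMeasure 1) μ)
    (act_meas : ∀ k, Measurable (act k))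
    (act_law : ∀ k, μ {ω | act k ω = true} = ENNReal.ofReal N.activeProb)
    (act_indep_h : ∀ k, IndepFun (act k) (h k) μ)
    (marks_indep : iIndepFun (fun k ω => (act k ω, h k ω)) μ) {x : ℕ → Plane}
    (hx : IsRegularConfiguration N.β x) :
    μ {ω | N.threshold ≤ N.sinr x (fun k => h k ω) (fun k => act k ω)}
      = ENNReal.ofReal (Real.exp (-(N.gainScale ‖x (serving x)‖ * N.σsq)))
        * expNeg (∑' k, if k = serving x then 0
          else ENNReal.ofReal (N.lossExponent (‖x k‖ / ‖x (serving x)‖))) := by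
  set s := serving x with hs
  set d := ‖x s‖ with hd
  have hd0 : 0 < d := hx.norm_pos s
  set a := N.gainScale d with ha
  have ha0 : 0 < a := N.gainScale_pos hd0
  have hP := N.P_pos
  -- the interference of station `k` as a function of its mark
  set T : ℕ → Bool × ℂ → ℝ := fun k m =>
    if k ≠ s ∧ m.1 = true then N.P * ‖m.2‖ ^ 2 * ‖x k‖ ^ (-N.β) else 0 with hT
  have hT0 : ∀ k m, 0 ≤ T k m := fun k m => by
    simp only [hT]
    split_ifs <;> positivity
  have hTm : ∀ k, Measurable (T k) := fun k => by
    exact Measurable.ite ((MeasurableSet.const _).inter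
      (measurable_fst (measurableSet_singleton true))) (by fun_prop) measurable_const
  have hmarks : ∀ k, Measurable fun ω => (act k ω, h k ω) := fun k =>
    (act_meas k).prodMk (h_meas k)
  set Z : ℕ → Ω → ℝ := fun n ω =>
    a * (∑ k ∈ (Finset.range n).erase s, T k (act k ω, h k ω) + N.σsq) with hZ
  have hTs : ∀ m, T s m = 0 := fun m => by simp [hT]
  have hZrange : ∀ n ω, Z n ω = a * (∑ k ∈ Finset.range n, T k (act k ω, h k ω) + N.σsq) :=
    fun n ω => by
      simp only [hZ]
      rw [Finset.sum_erase]
      exact hTs _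
  have hZm : ∀ n, Measurable (Z n) := fun n => by
    refine ((Finset.measurable_fun_sum _ fun k _ => (hTm k).comp (hmarks k)).add_const _).const_mul _
  have hZ0 : ∀ n ω, 0 ≤ Z n ω := fun n ω =>
    mul_nonneg ha0.le (add_nonneg (Finset.sum_nonneg fun k _ => hT0 _ _) N.σsq_pos.le)
  have hYm : Measurable fun ω => ‖h s ω‖ ^ 2 := by
    have := h_meas s
    fun_prop
  -- the success event for the first `n` interferers
  set E : ℕ → Set Ω := fun n => {ω | Z n ω ≤ ‖h s ω‖ ^ 2} with hE
  have hEm : ∀ n, MeasurableSet (E n) := fun n => measurableSet_le (hZm n) hYm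
  have hEanti : Antitone E := by
    refine antitone_nat_of_succ_le fun n ω hω => ?_
    have hω : Z (n + 1) ω ≤ ‖h s ω‖ ^ 2 := hω
    change Z n ω ≤ ‖h s ω‖ ^ 2
    refine le_trans ?_ hω
    rw [hZrange, hZrange, Finset.sum_range_succ]
    have := hT0 n (act n ω, h n ω)
    gcongr
    linarith
  have hEinter : {ω | N.threshold ≤ N.sinr x (fun k => h k ω) (fun k => act k ω)} =ᵐ[μ] ⋂ n, E n := by
    filter_upwards [N.ae_summable_interferenceTerm (act := act) h_meas h_law hx] with ω hω
    refine propext ?_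
    change N.threshold ≤ N.sinr x (fun k => h k ω) (fun k => act k ω) ↔ ω ∈ ⋂ n, E n
    rw [N.threshold_le_sinr_iff hd0, mem_iInter]
    have hlim : Tendsto (fun n => Z n ω) atTop (𝓝 (a * ((∑' k,
        N.interferenceTerm x (fun k => h k ω) (fun k => act k ω) k) + N.σsq))) := by
      simp_rw [hZrange]
      exact (hω.hasSum.tendsto_sum_nat.add_const _).const_mul _
    constructor
    · intro hle n
      refine le_trans ?_ hle
      rw [hZrange]
      gcongr
      exact hω.sum_le_tsum (Finset.range n) fun k _ => hT0 k _
    · intro hle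
      exact le_of_tendsto' hlim hle
  -- by independence the probabilities of these events are products
  set U : ℕ → ENNReal := fun k => if k = s then 0
    else ENNReal.ofReal (N.lossExponent (‖x k‖ / d)) with hU
  have hfactor : ∀ k, ∫⁻ ω, ENNReal.ofReal (Real.exp (-(a * T k (act k ω, h k ω)))) ∂μ
      = expNeg (U k) := fun k => by
    by_cases hk : k = s
    · simp [hU, hk, hTs]
    · have hxk := hx.norm_pos k
      have hc : 0 ≤ N.threshold * (‖x k‖ / d) ^ (-N.β) := by
        have := N.threshold_pos
        positivity
      have hcT : ∀ ω, a * T k (act k ω, h k ω) = if act k ω = true then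
          N.threshold * (‖x k‖ / d) ^ (-N.β) * ‖h k ω‖ ^ 2 else 0 := fun ω => by
        simp only [hT, hk, ne_eq, not_false_eq_true, true_and]
        split_ifs
        · rw [ha, gainScale, Real.div_rpow hxk.le hd0.le, Real.rpow_neg hd0.le, div_inv_eq_mul]
          field_simp
        · simp
      simp_rw [hcT]
      rw [lintegral_exp_neg_mark N.activeProb_nonneg hp1 (act_meas k) (h_meas k) (h_law k)
        (act_law k) (act_indep_h k) hc]
      simp only [hU, hk, if_false]
      rw [N.expNeg_lossExponent hp1 (by positivity), blocking]
  have hprob : ∀ n, μ (E n) = ENNReal.ofReal (Real.exp (-(a * N.σsq)))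
      * expNeg (∑ k ∈ Finset.range n, U k) := fun n => by
    have hind : IndepFun (Z n) (fun ω => ‖h s ω‖ ^ 2) μ := by
      have hdisj : Disjoint ((Finset.range n).erase s) {s} := by simp
      have hi := marks_indep.indepFun_finset _ _ hdisj hmarks
      have hTk : ∀ k : ((Finset.range n).erase s : Finset ℕ),
          Measurable fun m : ((Finset.range n).erase s : Finset ℕ) → Bool × ℂ => T k (m k) :=
        fun k => (hTm k).comp (measurable_pi_apply k)
      have hφm : Measurable fun m : ((Finset.range n).erase s : Finset ℕ) → Bool × ℂ =>
          a * (∑ k : ((Finset.range n).erase s : Finset ℕ), T k (m k) + N.σsq) :=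
        ((Finset.measurable_fun_sum _ fun k _ => hTk k).add_const _).const_mul _
      have hψm : Measurable fun m : ({s} : Finset ℕ) → Bool × ℂ =>
          ‖(m ⟨s, Finset.mem_singleton_self s⟩).2‖ ^ 2 := by fun_prop
      have hcomp := hi.comp hφm hψm
      have hZcomp : Z n = (fun m : ((Finset.range n).erase s : Finset ℕ) → Bool × ℂ =>
          a * (∑ k : ((Finset.range n).erase s : Finset ℕ), T k (m k) + N.σsq)) ∘
          fun ω k => (act k ω, h k ω) := by
        funext ω
        simp only [Function.comp_apply, hZ]
        rw [← Finset.sum_coe_sort _ fun k => T k (act k ω, h k ω)]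
      rw [hZcomp]
      exact hcomp
    rw [measure_le_of_hasLaw_expMeasure (h_law s) hYm (hZm n) hind (hZ0 n)]
    have hpt : ∀ ω, ENNReal.ofReal (Real.exp (-Z n ω)) = ENNReal.ofReal (Real.exp (-(a * N.σsq)))
        * ∏ k ∈ Finset.range n, ENNReal.ofReal (Real.exp (-(a * T k (act k ω, h k ω)))) :=
      fun ω => by
      rw [← ENNReal.ofReal_prod_of_nonneg fun k _ => (Real.exp_pos _).le, ← Real.exp_sum,
        ← ENNReal.ofReal_mul (Real.exp_pos _).le, ← Real.exp_add, hZrange, Finset.sum_neg_distrib,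
        ← Finset.mul_sum]
      congr 2
      ring
    simp_rw [hpt]
    have hfm : ∀ k, Measurable fun m => ENNReal.ofReal (Real.exp (-(a * T k m))) := fun k => by
      have := hTm k
      fun_prop
    have hfm' : ∀ k, Measurable fun ω =>
        ENNReal.ofReal (Real.exp (-(a * T k (act k ω, h k ω)))) := fun k => (hfm k).comp (hmarks k)
    rw [lintegral_const_mul _ (Finset.measurable_fun_prod _ fun k _ => hfm' k), expNeg_sum]
    congr 1
    refine (lintegral_prod_eq_prod_lintegral_of_indepFun (Finset.range n) _
      (marks_indep.comp (fun k m => ENNReal.ofReal (Real.exp (-(a * T k m)))) hfm)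
      fun k => (hfm k).comp (hmarks k)).trans (Finset.prod_congr rfl fun k _ => hfactor k)
  rw [measure_congr hEinter]
  have hl1 := tendsto_measure_iInter_atTop (μ := μ) (fun n => (hEm n).nullMeasurableSet) hEanti
    ⟨0, measure_ne_top _ _⟩
  have hl2 : Tendsto (fun n => μ (E n)) atTop
      (𝓝 (ENNReal.ofReal (Real.exp (-(a * N.σsq))) * expNeg (∑' k, U k))) := by
    simp_rw [hprob]
    exact ENNReal.Tendsto.const_mul ((continuous_expNeg.tendsto _).comp
      (ENNReal.summable.hasSum.tendsto_sum_nat)) (Or.inr ENNReal.ofReal_ne_top)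
  exact tendsto_nhds_unique hl1 hl2

end Downlink

end CacheNetwork

/-! ### Restriction properties of the Poisson process -/

namespace IsPoissonPointProcess

variable {Ω : Type*} [MeasurableSpace Ω] {μ : Measure Ω} {X : ℕ → Ω → Plane} {φ : ℝ}
  (hX : IsPoissonPointProcess X φ μ)
include hX

lemma measurableSet_forall_le_norm (a : ℝ) : MeasurableSet {ω | ∀ k, a ≤ ‖X k ω‖} := by
  have : {ω | ∀ k, a ≤ ‖X k ω‖} = ⋂ k, {ω | a ≤ ‖X k ω‖} := by ext; simp
  rw [this]
  exact MeasurableSet.iInter fun k => measurableSet_le measurable_const (hX.measurable k).norm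

variable [IsProbabilityMeasure μ]

/-- The Laplace functional for a function that is infinite on a disc: the event that the disc is
empty splits off as a factor. -/
lemma setLIntegral_expNeg_of_forall_le_norm (hφ : 0 ≤ φ) {v : Plane → ENNReal} (hv : Measurable v)
    {a : ℝ} (hva : ∀ y, ‖y‖ < a → v y = 0) :
    ∫⁻ ω in {ω | ∀ k, a ≤ ‖X k ω‖}, expNeg (∑' k, v (X k ω)) ∂μ
      = expNeg (ENNReal.ofReal φ * volume (Metric.ball (0 : Plane) a))
        * ∫⁻ ω, expNeg (∑' k, v (X k ω)) ∂μ := by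
  set w : Plane → ENNReal := (Metric.ball 0 a).indicator fun _ => ⊤ with hw
  have hwm : Measurable w := measurable_const.indicator measurableSet_ball
  have h := hX.laplaceFunctional hφ (hwm.add hv)
  have hleft : ∀ ω, expNeg (∑' k, (w + v) (X k ω)) = {ω | ∀ k, a ≤ ‖X k ω‖}.indicator
      (fun ω => expNeg (∑' k, v (X k ω))) ω := fun ω => by
    simp only [Pi.add_apply]
    rw [ENNReal.tsum_add, expNeg_add]
    by_cases hω : ω ∈ {ω | ∀ k, a ≤ ‖X k ω‖}
    · have h0 : ∀ k, w (X k ω) = 0 := fun k =>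
        Set.indicator_of_notMem (by simpa using hω k) _
      rw [Set.indicator_of_mem hω]
      simp [h0]
    · rw [Set.indicator_of_notMem hω]
      simp only [mem_ofPred_eq, not_forall, not_le] at hω
      obtain ⟨k, hk⟩ := hω
      have h1 : w (X k ω) = ⊤ := Set.indicator_of_mem (mem_ball_zero_iff.2 hk) _
      rw [ENNReal.tsum_eq_top_of_eq_top ⟨k, h1⟩, expNeg_top, zero_mul]
  have hright : ∀ y, 1 - expNeg ((w + v) y)
      = (Metric.ball (0 : Plane) a).indicator 1 y + (1 - expNeg (v y)) := fun y => by
    by_cases hy : y ∈ Metric.ball (0 : Plane) a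
    · simp [hw, Set.indicator_of_mem hy, hva y (mem_ball_zero_iff.1 hy)]
    · simp [hw, Set.indicator_of_notMem hy]
  simp_rw [hleft, hright] at h
  rw [lintegral_indicator (hX.measurableSet_forall_le_norm a),
    lintegral_add_left (measurable_one.indicator measurableSet_ball),
    lintegral_indicator_one measurableSet_ball, mul_add, expNeg_add,
    ← hX.laplaceFunctional hφ hv] at h
  exact h

lemma measure_forall_le_norm (hφ : 0 ≤ φ) (a : ℝ) :
    μ {ω | ∀ k, a ≤ ‖X k ω‖}
      = expNeg (ENNReal.ofReal φ * volume (Metric.ball (0 : Plane) a)) := by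
  simpa using hX.setLIntegral_expNeg_of_forall_le_norm hφ (v := 0) measurable_zero (a := a)
    (fun _ _ => rfl)

/-- Functionals of the points outside the disc of radius `b` are independent of the event that the
nearest point lies at a distance in `[a, b)`. -/
lemma setLIntegral_ring (hφ : 0 ≤ φ) {v : Plane → ENNReal} (hv : Measurable v) {a b : ℝ}
    (hab : a ≤ b) (hvb : ∀ y, ‖y‖ < b → v y = 0) :
    ∫⁻ ω in {ω | ∀ k, a ≤ ‖X k ω‖} \ {ω | ∀ k, b ≤ ‖X k ω‖}, expNeg (∑' k, v (X k ω)) ∂μ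
      = μ ({ω | ∀ k, a ≤ ‖X k ω‖} \ {ω | ∀ k, b ≤ ‖X k ω‖})
        * ∫⁻ ω, expNeg (∑' k, v (X k ω)) ∂μ := by
  set A := {ω | ∀ k, a ≤ ‖X k ω‖} with hA
  set B := {ω | ∀ k, b ≤ ‖X k ω‖} with hB
  have hBA : B ⊆ A := fun ω hω k => hab.trans (hω k)
  have hBm : MeasurableSet B := hX.measurableSet_forall_le_norm b
  set I := ∫⁻ ω, expNeg (∑' k, v (X k ω)) ∂μ with hI
  have hIfin : I ≠ ⊤ := by
    refine ((lintegral_mono fun ω => expNeg_le_one _).trans_lt ?_ : I < ⊤).ne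
    simp
  have h1 : ∫⁻ ω in A, expNeg (∑' k, v (X k ω)) ∂μ = μ A * I := by
    rw [hX.setLIntegral_expNeg_of_forall_le_norm hφ hv fun y hy => hvb y (hy.trans_le hab),
      ← hX.measure_forall_le_norm hφ]
  have h2 : ∫⁻ ω in B, expNeg (∑' k, v (X k ω)) ∂μ = μ B * I := by
    rw [hX.setLIntegral_expNeg_of_forall_le_norm hφ hv hvb, ← hX.measure_forall_le_norm hφ]
  have h3 := lintegral_inter_add_sdiff (μ := μ) (fun ω => expNeg (∑' k, v (X k ω))) A hBm
  have h4 := measure_inter_add_sdiff (μ := μ) A hBm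
  rw [inter_eq_self_of_subset_right hBA] at h3 h4
  rw [h1, h2, ← h4, add_mul] at h3
  exact (ENNReal.add_right_inj (ENNReal.mul_ne_top (measure_ne_top _ _) hIfin)).1 h3

end IsPoissonPointProcess

namespace CacheNetwork

/-! ### The nearest base station -/

lemma measurable_serving : Measurable serving := by
  have hA : ∀ k, MeasurableSet {x : ℕ → Plane | ∀ j, ‖x k‖ ≤ ‖x j‖} := fun k => by
    have : {x : ℕ → Plane | ∀ j, ‖x k‖ ≤ ‖x j‖} = ⋂ j, {x | ‖x k‖ ≤ ‖x j‖} := by ext; simp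
    rw [this]
    exact MeasurableSet.iInter fun j =>
      measurableSet_le (measurable_pi_apply k).norm (measurable_pi_apply j).norm
  refine measurable_of_Iic fun n => ?_
  have hset : serving ⁻¹' Iic n = (⋃ k ∈ Iic n, {x : ℕ → Plane | ∀ j, ‖x k‖ ≤ ‖x j‖})
      ∪ ⋂ k, {x : ℕ → Plane | ∀ j, ‖x k‖ ≤ ‖x j‖}ᶜ := by
    ext x
    simp only [mem_preimage, mem_Iic, mem_union, mem_iUnion, mem_iInter, mem_compl_iff,
      mem_ofPred_eq, exists_prop]
    constructor
    · intro hx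
      by_cases hne : {k | ∀ j, ‖x k‖ ≤ ‖x j‖}.Nonempty
      · exact Or.inl ⟨_, hx, Nat.sInf_mem hne⟩
      · exact Or.inr fun k hk => hne ⟨k, hk⟩
    · rintro (⟨k, hkn, hk⟩ | hx)
      · exact (Nat.sInf_le (s := {k | ∀ j, ‖x k‖ ≤ ‖x j‖}) hk).trans hkn
      · have : {k | ∀ j, ‖x k‖ ≤ ‖x j‖} = ∅ := by
          ext k
          simpa using hx k
        rw [serving, this, Nat.sInf_empty]
        exact Nat.zero_le n
  rw [hset]
  exact (MeasurableSet.biUnion (to_countable _) fun k _ => hA k).union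
    (MeasurableSet.iInter fun k => (hA k).compl)

/-- The distance of the serving base station. -/
def servingDist (x : ℕ → Plane) : ℝ := ‖x (serving x)‖

lemma measurable_servingDist : Measurable servingDist := by
  have h1 : Measurable fun p : (ℕ → Plane) × ℕ => ‖p.1 p.2‖ :=
    measurable_from_prod_countable_left fun k => (measurable_pi_apply k).norm
  have h2 : Measurable fun x : ℕ → Plane => (x, serving x) :=
    measurable_id'.prodMk measurable_serving
  have h3 := h1.comp h2
  exact h3

lemma le_servingDist_iff {β : ℝ} {x : ℕ → Plane} (hx : IsRegularConfiguration β x) {a : ℝ} :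
    a ≤ servingDist x ↔ ∀ k, a ≤ ‖x k‖ :=
  ⟨fun h k => h.trans (hx.norm_serving_le k), fun h => h _⟩

variable (N : CacheNetwork)

/-! ### The interferers outside a disc -/

lemma measurable_blocking : Measurable N.blocking := by
  unfold blocking
  fun_prop

@[fun_prop] lemma measurable_lossExponent : Measurable N.lossExponent := by
  have := N.measurable_blocking
  unfold lossExponent
  fun_prop

lemma integrableOn_mul_blocking : IntegrableOn (fun t => t * N.blocking t) (Ioi 1) := by
  have hβ := N.two_lt_β
  refine Integrable.mono' ((integrableOn_Ioi_rpow_of_lt (a := 1 - N.β) (by linarith)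
    one_pos).const_mul N.threshold)
    (measurable_id.mul N.measurable_blocking).aestronglyMeasurable ?_
  filter_upwards [ae_restrict_mem measurableSet_Ioi] with t ht
  have ht0 : 0 < t := zero_lt_one.trans ht
  have hT := N.threshold_pos
  rw [Real.norm_of_nonneg (mul_nonneg ht0.le (N.blocking_nonneg ht0.le)), sub_eq_add_neg,
    Real.rpow_add ht0, Real.rpow_one, mul_left_comm]
  gcongr
  refine div_le_self (by positivity) ?_
  have : 0 ≤ N.threshold * t ^ (-N.β) := by positivity
  linarith

lemma Z₁_threshold_nonneg : 0 ≤ N.Z₁ N.threshold := by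
  rw [Z₁_threshold_eq]
  refine mul_nonneg zero_le_two (setIntegral_nonneg measurableSet_Ioi fun t (ht : 1 < t) => ?_)
  have : 0 ≤ t := by linarith
  exact mul_nonneg this (N.blocking_nonneg this)

/-- The loss exponent caused by a possible interferer at `y`, for a serving station at distance
`b`; there are no interferers inside the disc of radius `b`. -/
def exteriorLoss (b : ℝ) (y : Plane) : ENNReal :=
  if b ≤ ‖y‖ then ENNReal.ofReal (N.lossExponent (‖y‖ / b)) else 0

lemma measurable_exteriorLoss_uncurry :
    Measurable fun p : ℝ × Plane => N.exteriorLoss p.1 p.2 :=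
  Measurable.ite (measurableSet_le measurable_fst measurable_snd.norm)
    (by fun_prop) measurable_const

lemma measurable_exteriorLoss (b : ℝ) : Measurable (N.exteriorLoss b) :=
  N.measurable_exteriorLoss_uncurry.comp (measurable_const.prodMk measurable_id)

lemma integral_blocking_exterior {b : ℝ} (hb : 0 < b) :
    Integrable (fun y : Plane => (Ioi b).indicator (fun t => N.blocking (t / b)) ‖y‖) ∧
    ∫ y : Plane, (Ioi b).indicator (fun t => N.blocking (t / b)) ‖y‖
      = Real.pi * b ^ 2 * N.Z₁ N.threshold := by
  have hrank : Module.finrank ℝ Plane = 2 := by simp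
  have hscale : ∀ t, b * t * N.blocking (b * t / b) = b * (t * N.blocking t) := fun t => by
    rw [mul_div_cancel_left₀ _ hb.ne', mul_assoc]
  have hint : IntegrableOn (fun t => t * N.blocking (t / b)) (Ioi b) := by
    have := (integrableOn_Ioi_comp_mul_left_iff (fun t => t * N.blocking (t / b)) 1 hb).1 (by
      simp_rw [hscale]
      exact N.integrableOn_mul_blocking.const_mul b)
    rwa [mul_one] at this
  have hval : ∫ t in Ioi b, t * N.blocking (t / b) = b ^ 2 * ∫ t in Ioi 1, t * N.blocking t := by
    have := integral_comp_mul_left_Ioi (fun t => t * N.blocking (t / b)) 1 hb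
    simp_rw [hscale] at this
    rw [integral_const_mul, mul_one, smul_eq_mul] at this
    field_simp at this
    linarith
  have hpoint : ∀ t, t ^ (2 - 1) • (Ioi b).indicator (fun t => N.blocking (t / b)) t
      = (Ioi b).indicator (fun t => t * N.blocking (t / b)) t := fun t => by
    by_cases ht : t ∈ Ioi b
    · simp [Set.indicator_of_mem ht]
    · simp [Set.indicator_of_notMem ht]
  constructor
  · rw [integrable_fun_norm_addHaar volume
      (f := (Ioi b).indicator fun t => N.blocking (t / b)), hrank]
    simp_rw [hpoint]
    exact (hint.integrable_indicator measurableSet_Ioi).integrableOn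
  · rw [integral_fun_norm_addHaar volume ((Ioi b).indicator fun t => N.blocking (t / b)), hrank,
      volume_real_ball_plane zero_le_one]
    simp_rw [hpoint]
    rw [setIntegral_indicator measurableSet_Ioi, inter_eq_self_of_subset_right
      (Ioi_subset_Ioi hb.le), hval, Z₁_threshold_eq]
    simp only [smul_eq_mul, nsmul_eq_mul]
    push_cast
    ring

/-- The probability that none of the interferers outside the disc of radius `r` defeats the
transmission from a station at distance `r`. -/
def exteriorFactor (r : ℝ) : ENNReal :=
  ENNReal.ofReal (Real.exp (-(Real.pi * r ^ 2 * (N.φa * N.Z₁ N.threshold))))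

variable {Ω : Type*} [MeasurableSpace Ω] {μ : Measure Ω} [IsProbabilityMeasure μ]
  {X : ℕ → Ω → Plane}

lemma lintegral_expNeg_exteriorLoss (hX : IsPoissonPointProcess X N.φb μ)
    (hp1 : N.activeProb ≤ 1) {b : ℝ} (hb : 0 < b) :
    ∫⁻ ω, expNeg (∑' k, N.exteriorLoss b (X k ω)) ∂μ = N.exteriorFactor b := by
  obtain ⟨hint, hval⟩ := N.integral_blocking_exterior hb
  have hp0 := N.activeProb_nonneg
  have hnn : ∀ t, 0 ≤ (Ioi b).indicator (fun t => N.blocking (t / b)) t := fun t =>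
    Set.indicator_nonneg (fun t (ht : b < t) => N.blocking_nonneg (by
      have : 0 < t := hb.trans ht
      positivity)) t
  have hsphere : ∀ᵐ y : Plane, ‖y‖ ≠ b := by
    rw [ae_iff]
    simp only [ne_eq, not_not]
    have : {y : Plane | ‖y‖ = b} = Metric.sphere 0 b := by ext; simp
    rw [this]
    exact Measure.addHaar_sphere volume 0 b
  have h1 : ∫⁻ y, (1 - expNeg (N.exteriorLoss b y)) = ∫⁻ y : Plane, ENNReal.ofReal
      (N.activeProb * (Ioi b).indicator (fun t => N.blocking (t / b)) ‖y‖) := by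
    refine lintegral_congr_ae ?_
    filter_upwards [hsphere] with y hy
    rw [exteriorLoss]
    split_ifs with hby
    · have ht : 0 ≤ ‖y‖ / b := by positivity
      have hmem : ‖y‖ ∈ Ioi b := lt_of_le_of_ne hby (Ne.symm hy)
      rw [N.expNeg_lossExponent hp1 ht, ← ENNReal.ofReal_one,
        ← ENNReal.ofReal_sub _ (N.one_sub_blocking_pos hp1 ht).le, sub_sub_cancel,
        Set.indicator_of_mem hmem]
    · have hmem : ‖y‖ ∉ Ioi b := fun h => hby (mem_Ioi.1 h).le
      rw [Set.indicator_of_notMem hmem]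
      simp
  rw [hX.laplaceFunctional N.φb_pos.le (N.measurable_exteriorLoss b), h1,
    ← ofReal_integral_eq_lintegral_ofReal (hint.const_mul _)
      (Eventually.of_forall fun y => mul_nonneg hp0 (hnn _)), integral_const_mul, hval,
    ← ENNReal.ofReal_mul N.φb_pos.le, expNeg_ofReal, exteriorFactor, φa]
  · congr 3
    ring
  · have := N.φb_pos
    have := N.Z₁_threshold_nonneg
    have := Real.pi_pos
    positivity

/-! ### Averaging over the positions of the base stations -/

/-- The probability that the noise alone does not defeat the transmission from a station at
distance `r`. -/
def noiseFactor (r : ℝ) : ENNReal := ENNReal.ofReal (Real.exp (-(N.gainScale r * N.σsq)))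

lemma continuous_noiseFactor : Continuous N.noiseFactor := by
  have := N.two_lt_β
  have h : Continuous fun r : ℝ => r ^ N.β := Real.continuous_rpow_const (by linarith)
  unfold noiseFactor gainScale
  exact ENNReal.continuous_ofReal.comp (by fun_prop)

lemma continuous_exteriorFactor : Continuous N.exteriorFactor :=
  ENNReal.continuous_ofReal.comp (by fun_prop)

lemma noiseFactor_le_one {r : ℝ} (hr : 0 < r) : N.noiseFactor r ≤ 1 := by
  refine ENNReal.ofReal_le_one.2 (Real.exp_le_one_iff.2 ?_)
  have := mul_pos (N.gainScale_pos hr) N.σsq_pos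
  linarith

lemma exteriorFactor_le_one (r : ℝ) : N.exteriorFactor r ≤ 1 := by
  refine ENNReal.ofReal_le_one.2 (Real.exp_le_one_iff.2 ?_)
  have h1 := N.Z₁_threshold_nonneg
  have h2 := mul_nonneg N.activeProb_nonneg N.φb_pos.le
  have := Real.pi_pos
  rw [φa]
  have : 0 ≤ Real.pi * r ^ 2 * (N.activeProb * N.φb * N.Z₁ N.threshold) := by positivity
  linarith

/-- The upper end of the cell of the grid `ℕ / (m + 1)` that contains the serving distance. -/
def gridDist (m : ℕ) (x : ℕ → Plane) : ℝ := (⌊((m : ℝ) + 1) * servingDist x⌋₊ + 1) / ((m : ℝ) + 1)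

lemma measurable_gridDist (m : ℕ) : Measurable (gridDist m) := by
  have h1 : Measurable fun x : ℕ → Plane => ⌊((m : ℝ) + 1) * servingDist x⌋₊ :=
    Nat.measurable_floor.comp (measurable_servingDist.const_mul _)
  have h2 : Measurable fun n : ℕ => ((n : ℝ) + 1) / ((m : ℝ) + 1) := .of_discrete
  exact h2.comp h1

lemma servingDist_lt_gridDist (m : ℕ) (x : ℕ → Plane) : servingDist x < gridDist m x := by
  rw [gridDist, lt_div_iff₀' (by positivity)]
  exact Nat.lt_floor_add_one _

lemma gridDist_le (m : ℕ) (x : ℕ → Plane) :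
    gridDist m x ≤ servingDist x + 1 / ((m : ℝ) + 1) := by
  have hm : (0 : ℝ) < (m : ℝ) + 1 := by positivity
  have := Nat.floor_le (mul_nonneg hm.le (norm_nonneg (x (serving x))))
  rw [gridDist, div_le_iff₀ hm, add_mul (servingDist x), one_div_mul_cancel hm.ne',
    mul_comm (servingDist x)]
  gcongr
  exact this

lemma tendsto_gridDist (x : ℕ → Plane) :
    Tendsto (fun m => gridDist m x) atTop (𝓝 (servingDist x)) := by
  refine tendsto_of_tendsto_of_tendsto_of_le_of_le tendsto_const_nhds ?_
    (fun m => (servingDist_lt_gridDist m x).le) (fun m => gridDist_le m x)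
  simpa using (tendsto_one_div_add_atTop_nhds_zero_nat (𝕜 := ℝ)).const_add (servingDist x)

lemma lintegral_gridDist (hX : IsPoissonPointProcess X N.φb μ) (hp1 : N.activeProb ≤ 1) (m : ℕ) :
    ∫⁻ ω, N.noiseFactor (gridDist m fun k => X k ω)
        * expNeg (∑' k, N.exteriorLoss (gridDist m fun k => X k ω) (X k ω)) ∂μ
      = ∫⁻ ω, N.noiseFactor (gridDist m fun k => X k ω)
        * N.exteriorFactor (gridDist m fun k => X k ω) ∂μ := by
  have hm : (0 : ℝ) < (m : ℝ) + 1 := by positivity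
  have hXm : Measurable fun ω k => X k ω := measurable_pi_lambda _ hX.measurable
  set J : Ω → ℕ := fun ω => ⌊((m : ℝ) + 1) * servingDist fun k => X k ω⌋₊ with hJ
  have hJm : Measurable J := Nat.measurable_floor.comp
    ((measurable_servingDist.comp hXm).const_mul _)
  have hgrid : ∀ ω, gridDist m (fun k => X k ω) = ((J ω : ℝ) + 1) / ((m : ℝ) + 1) := fun ω => rfl
  have hsplit : ∀ f : Ω → ENNReal, ∫⁻ ω, f ω ∂μ = ∑' i, ∫⁻ ω in J ⁻¹' {i}, f ω ∂μ := fun f => by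
    rw [← lintegral_iUnion (fun i => hJm (measurableSet_singleton i)) (fun i j hij =>
      (disjoint_singleton.2 hij).preimage J), ← preimage_iUnion, iUnion_of_singleton,
      preimage_univ, setLIntegral_univ]
  rw [hsplit, hsplit fun ω => N.noiseFactor (gridDist m fun k => X k ω)
        * N.exteriorFactor (gridDist m fun k => X k ω)]
  refine tsum_congr fun i => ?_
  set b : ℝ := ((i : ℝ) + 1) / ((m : ℝ) + 1) with hb
  have hb0 : 0 < b := by positivity
  have hcell : (J ⁻¹' {i} : Set Ω) =ᵐ[μ] ({ω | ∀ k, (i : ℝ) / ((m : ℝ) + 1) ≤ ‖X k ω‖} \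
      {ω | ∀ k, b ≤ ‖X k ω‖} : Set Ω) := by
    filter_upwards [hX.ae_isRegularConfiguration N.φb_pos.le N.two_lt_β] with ω hω
    refine propext ?_
    change J ω = i ↔ (∀ k, (i : ℝ) / ((m : ℝ) + 1) ≤ ‖X k ω‖) ∧ ¬∀ k, b ≤ ‖X k ω‖
    rw [← le_servingDist_iff hω, ← le_servingDist_iff hω, not_le, hb, div_le_iff₀' hm,
      lt_div_iff₀' hm, hJ]
    exact Nat.floor_eq_iff (mul_nonneg hm.le (norm_nonneg _))
  have hon : ∀ F : ℝ → Ω → ENNReal, ∫⁻ ω in J ⁻¹' {i}, F (gridDist m fun k => X k ω) ω ∂μ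
      = ∫⁻ ω in J ⁻¹' {i}, F b ω ∂μ := fun F =>
    setLIntegral_congr_fun (hJm (measurableSet_singleton i)) fun ω (hω : J ω = i) => by
      rw [hgrid, hω]
  rw [hon fun q ω => N.noiseFactor q * expNeg (∑' k, N.exteriorLoss q (X k ω)),
    hon fun q ω => N.noiseFactor q * N.exteriorFactor q, setLIntegral_congr hcell,
    setLIntegral_congr hcell, lintegral_const_mul, hX.setLIntegral_ring N.φb_pos.le
      (N.measurable_exteriorLoss b) (by rw [hb]; gcongr; linarith) (fun y hy => if_neg hy.not_ge),
    N.lintegral_expNeg_exteriorLoss hX hp1 hb0, setLIntegral_const]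
  · ring
  · exact measurable_expNeg.comp
      (Measurable.tsum fun k => (N.measurable_exteriorLoss b).comp (hX.measurable k))

lemma continuousAt_lossExponent (hp1 : N.activeProb ≤ 1) {t : ℝ} (ht : 0 < t) :
    ContinuousAt N.lossExponent t := by
  have hT := N.threshold_pos
  have h1 : ContinuousAt (fun t : ℝ => t ^ (-N.β)) t :=
    Real.continuousAt_rpow_const _ _ (Or.inl ht.ne')
  have h2 : ContinuousAt N.blocking t := by
    refine ContinuousAt.div (h1.const_mul _) ((h1.const_mul _).const_add 1) ?_
    positivity
  exact (((h2.const_mul _).const_sub 1).log (N.one_sub_blocking_pos hp1 ht.le).ne').neg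

lemma tendsto_tsum_exteriorLoss (hp1 : N.activeProb ≤ 1) {x : ℕ → Plane}
    (hx : IsRegularConfiguration N.β x) :
    Tendsto (fun m => ∑' k, N.exteriorLoss (gridDist m x) (x k)) atTop
      (𝓝 (∑' k, if k = serving x then 0
        else ENNReal.ofReal (N.lossExponent (‖x k‖ / ‖x (serving x)‖)))) := by
  set s := serving x with hs
  have hd0 : 0 < servingDist x := hx.norm_pos s
  have hq0 : ∀ m, 0 < gridDist m x := fun m => hd0.trans (servingDist_lt_gridDist m x)
  have hT := N.threshold_pos
  have hβ := N.two_lt_β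
  set f : ℕ → ℕ → ℝ := fun m k =>
    if gridDist m x ≤ ‖x k‖ then N.lossExponent (‖x k‖ / gridDist m x) else 0 with hf
  set g : ℕ → ℝ := fun k =>
    if k = s then 0 else N.lossExponent (‖x k‖ / servingDist x) with hg
  set bd : ℕ → ℝ := fun k =>
    N.threshold * ((servingDist x + 1) ^ N.β * ‖x k‖ ^ (-N.β)) with hbd
  have hbd_sum : Summable bd := (hx.summable.mul_left _).mul_left _
  have hle : ∀ {q : ℝ}, 0 < q → q ≤ servingDist x + 1 → ∀ k,
      N.lossExponent (‖x k‖ / q) ≤ bd k := fun {q} hq hq1 k => by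
    have hxk := hx.norm_pos k
    refine (N.lossExponent_le hp1 (by positivity)).trans ?_
    rw [Real.div_rpow hxk.le hq.le, Real.rpow_neg hq.le, div_inv_eq_mul, mul_comm (_ ^ (-N.β))]
    simp only [hbd]
    gcongr
  have hq1 : ∀ m, gridDist m x ≤ servingDist x + 1 := fun m => by
    refine (gridDist_le m x).trans ?_
    gcongr
    rw [div_le_one (by positivity)]
    simp
  have hf0 : ∀ m k, 0 ≤ f m k := fun m k => by
    simp only [hf]
    split_ifs
    · exact N.lossExponent_nonneg hp1 (div_nonneg (norm_nonneg _) (hq0 m).le)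
    · exact le_rfl
  have hfbd : ∀ m k, f m k ≤ bd k := fun m k => by
    have hxk := hx.norm_pos k
    simp only [hf]
    split_ifs
    · exact hle (hq0 m) (hq1 m) k
    · simp only [hbd]
      positivity
  have hg0 : ∀ k, 0 ≤ g k := fun k => by
    simp only [hg]
    split_ifs
    · exact le_rfl
    · exact N.lossExponent_nonneg hp1 (div_nonneg (norm_nonneg _) hd0.le)
  have hgbd : ∀ k, g k ≤ bd k := fun k => by
    have hxk := hx.norm_pos k
    simp only [hg]
    split_ifs
    · simp only [hbd]
      positivity
    · exact hle hd0 (by linarith) k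
  have hlim : ∀ k, Tendsto (fun m => f m k) atTop (𝓝 (g k)) := fun k => by
    by_cases hk : k = s
    · have : ∀ m, f m k = g k := fun m => by
        simp only [hf, hg, hk, if_true]
        exact if_neg (servingDist_lt_gridDist m x).not_ge
      simp_rw [this]
      exact tendsto_const_nhds
    · have hlt : servingDist x < ‖x k‖ := hx.norm_serving_lt hk
      simp only [hg, hk, if_false]
      have hcont := (N.continuousAt_lossExponent hp1 (div_pos (hx.norm_pos k) hd0)).tendsto.comp
        (Tendsto.div tendsto_const_nhds (tendsto_gridDist x) hd0.ne')
      refine hcont.congr' ?_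
      filter_upwards [(tendsto_gridDist x).eventually_le_const hlt] with m hm
      simp only [hf, hm, if_true, Function.comp_apply, Pi.div_apply]
  have hreal := tendsto_tsum_of_dominated_convergence hbd_sum hlim
    (Eventually.of_forall fun m k => by
      rw [Real.norm_of_nonneg (hf0 m k)]
      exact hfbd m k)
  have h1 : ∀ m, ∑' k, N.exteriorLoss (gridDist m x) (x k) = ENNReal.ofReal (∑' k, f m k) :=
    fun m => by
    rw [ENNReal.ofReal_tsum_of_nonneg (hf0 m) (hbd_sum.of_nonneg_of_le (hf0 m) (hfbd m))]
    refine tsum_congr fun k => ?_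
    simp only [exteriorLoss, hf]
    split_ifs <;> simp
  have h2 : (∑' k, if k = s then 0
        else ENNReal.ofReal (N.lossExponent (‖x k‖ / ‖x s‖))) = ENNReal.ofReal (∑' k, g k) := by
    rw [ENNReal.ofReal_tsum_of_nonneg hg0 (hbd_sum.of_nonneg_of_le hg0 hgbd)]
    refine tsum_congr fun k => ?_
    simp only [hg, servingDist, ← hs]
    split_ifs <;> simp
  simp_rw [h1]
  rw [h2]
  exact ENNReal.tendsto_ofReal hreal

/-- The probability of success for given positions averages to the expectation of a function of
the serving distance alone. The serving distance is replaced by its upper end in a grid, which the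
points outside the corresponding disc do not influence, and the grid is refined. -/
theorem lintegral_success_eq (hX : IsPoissonPointProcess X N.φb μ) (hp1 : N.activeProb ≤ 1) :
    ∫⁻ ω, N.noiseFactor (servingDist fun k => X k ω)
        * expNeg (∑' k, if k = serving (fun k => X k ω) then 0
          else ENNReal.ofReal (N.lossExponent (‖X k ω‖ / ‖X (serving fun k => X k ω) ω‖))) ∂μ
      = ∫⁻ ω, N.noiseFactor (servingDist fun k => X k ω)
        * N.exteriorFactor (servingDist fun k => X k ω) ∂μ := by
  have hXm : Measurable fun ω k => X k ω := measurable_pi_lambda _ hX.measurable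
  have hqm : ∀ m, Measurable fun ω => gridDist m fun k => X k ω := fun m =>
    (measurable_gridDist m).comp hXm
  have hreg := hX.ae_isRegularConfiguration N.φb_pos.le N.two_lt_β
  have hq0 : ∀ {x : ℕ → Plane}, IsRegularConfiguration N.β x → ∀ m, 0 < gridDist m x :=
    fun hx m => (hx.norm_pos _).trans (servingDist_lt_gridDist m _)
  have hnoise : ∀ x : ℕ → Plane, Tendsto (fun m => N.noiseFactor (gridDist m x)) atTop
      (𝓝 (N.noiseFactor (servingDist x))) := fun x =>
    (N.continuous_noiseFactor.tendsto _).comp (tendsto_gridDist x)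
  have hleft : Tendsto (fun m => ∫⁻ ω, N.noiseFactor (gridDist m fun k => X k ω)
        * expNeg (∑' k, N.exteriorLoss (gridDist m fun k => X k ω) (X k ω)) ∂μ) atTop
      (𝓝 (∫⁻ ω, N.noiseFactor (servingDist fun k => X k ω)
        * expNeg (∑' k, if k = serving (fun k => X k ω) then 0
          else ENNReal.ofReal (N.lossExponent (‖X k ω‖ / ‖X (serving fun k => X k ω) ω‖))) ∂μ)) := by
    refine tendsto_lintegral_of_dominated_convergence' (fun _ => 1) (fun m => ?_) (fun m => ?_)
      (by simp) ?_
    · refine (((N.continuous_noiseFactor.measurable.comp (hqm m)).mul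
        (measurable_expNeg.comp (Measurable.tsum fun k => ?_)))).aemeasurable
      exact N.measurable_exteriorLoss_uncurry.comp ((hqm m).prodMk (hX.measurable k))
    · filter_upwards [hreg] with ω hω
      exact mul_le_one' (N.noiseFactor_le_one (hq0 hω m)) (expNeg_le_one _)
    · filter_upwards [hreg] with ω hω
      exact ENNReal.Tendsto.mul (hnoise _) (Or.inr (expNeg_ne_top _))
        ((continuous_expNeg.tendsto _).comp (N.tendsto_tsum_exteriorLoss hp1 hω))
        (Or.inr ENNReal.ofReal_ne_top)
  have hright : Tendsto (fun m => ∫⁻ ω, N.noiseFactor (gridDist m fun k => X k ω)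
        * N.exteriorFactor (gridDist m fun k => X k ω) ∂μ) atTop
      (𝓝 (∫⁻ ω, N.noiseFactor (servingDist fun k => X k ω)
        * N.exteriorFactor (servingDist fun k => X k ω) ∂μ)) := by
    refine tendsto_lintegral_of_dominated_convergence' (fun _ => 1) (fun m => ?_) (fun m => ?_)
      (by simp) ?_
    · exact ((N.continuous_noiseFactor.measurable.comp (hqm m)).mul
        (N.continuous_exteriorFactor.measurable.comp (hqm m))).aemeasurable
    · filter_upwards [hreg] with ω hω
      exact mul_le_one' (N.noiseFactor_le_one (hq0 hω m)) (N.exteriorFactor_le_one _)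
    · filter_upwards [hreg] with ω hω
      exact ENNReal.Tendsto.mul (hnoise _) (Or.inr ENNReal.ofReal_ne_top)
        ((N.continuous_exteriorFactor.tendsto _).comp (tendsto_gridDist _))
        (Or.inr ENNReal.ofReal_ne_top)
  exact tendsto_nhds_unique hleft (hright.congr fun m => (N.lintegral_gridDist hX hp1 m).symm)

end CacheNetwork

namespace CacheNetwork

variable (N : CacheNetwork)

/-! ### The density of the serving distance -/

/-- The density of the distance of the nearest base station, on `(0, ∞)`. -/
def servingDensity (r : ℝ) : ℝ :=
  2 * Real.pi * N.φb * (r * Real.exp (-(Real.pi * N.φb) * r ^ 2))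

lemma integrable_servingDensity : Integrable N.servingDensity :=
  (integrable_mul_exp_neg_mul_sq (mul_pos Real.pi_pos N.φb_pos)).const_mul _

lemma servingDensity_nonneg {r : ℝ} (hr : 0 ≤ r) : 0 ≤ N.servingDensity r := by
  have := Real.pi_pos
  have := N.φb_pos
  rw [servingDensity]
  positivity

@[fun_prop] lemma measurable_servingDensity : Measurable N.servingDensity := by
  unfold servingDensity
  fun_prop

lemma integral_servingDensity (a : ℝ) :
    ∫ r in Ioi a, N.servingDensity r = Real.exp (-(Real.pi * N.φb) * a ^ 2) := by
  have hc : 0 < Real.pi * N.φb := mul_pos Real.pi_pos N.φb_pos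
  have hderiv : ∀ r : ℝ, HasDerivAt (fun r => -Real.exp (-(Real.pi * N.φb) * r ^ 2))
      (N.servingDensity r) r := fun r => by
    have := (((hasDerivAt_pow 2 r).const_mul (-(Real.pi * N.φb))).exp).neg
    convert! this using 1
    rw [servingDensity]
    push_cast
    ring
  have hlim : Tendsto (fun r : ℝ => -Real.exp (-(Real.pi * N.φb) * r ^ 2)) atTop (𝓝 0) := by
    rw [← neg_zero]
    refine (Real.tendsto_exp_atBot.comp ?_).neg
    exact (tendsto_pow_atTop two_ne_zero).const_mul_atTop_of_neg (by linarith)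
  have := integral_Ioi_of_hasDerivAt_of_tendsto (hderiv a).continuousAt.continuousWithinAt
    (fun r _ => hderiv r) N.integrable_servingDensity.integrableOn hlim
  rw [this]
  ring

variable {Ω : Type*} [MeasurableSpace Ω] {μ : Measure Ω} [IsProbabilityMeasure μ]
  {X : ℕ → Ω → Plane}

lemma map_servingDist_eq (hX : IsPoissonPointProcess X N.φb μ) :
    μ.map (fun ω => servingDist fun k => X k ω)
      = (volume.restrict (Ioi 0)).withDensity fun r => ENNReal.ofReal (N.servingDensity r) := by
  have hXm : Measurable fun ω k => X k ω := measurable_pi_lambda _ hX.measurable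
  have hDm : Measurable fun ω => servingDist fun k => X k ω := measurable_servingDist.comp hXm
  have := Measure.isProbabilityMeasure_map (μ := μ) hDm.aemeasurable
  refine Measure.ext_of_Ici _ _ fun a => ?_
  have hleft : μ.map (fun ω => servingDist fun k => X k ω) (Ici a)
      = ENNReal.ofReal (Real.exp (-(Real.pi * N.φb) * (a ⊔ 0) ^ 2)) := by
    have hset : ((fun ω => servingDist fun k => X k ω) ⁻¹' Ici a : Set Ω)
        =ᵐ[μ] {ω | ∀ k, a ⊔ 0 ≤ ‖X k ω‖} := by
      filter_upwards [hX.ae_isRegularConfiguration N.φb_pos.le N.two_lt_β] with ω hω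
      refine propext ?_
      change a ≤ servingDist (fun k => X k ω) ↔ ∀ k, a ⊔ 0 ≤ ‖X k ω‖
      rw [le_servingDist_iff hω]
      simp
    have h0 : 0 ≤ a ⊔ 0 := le_sup_right
    rw [Measure.map_apply hDm measurableSet_Ici, measure_congr hset,
      hX.measure_forall_le_norm N.φb_pos.le, ← ofReal_measureReal measure_ball_lt_top.ne,
      volume_real_ball_plane h0, ← ENNReal.ofReal_mul N.φb_pos.le, expNeg_ofReal]
    · congr 2
      ring
    · have := N.φb_pos
      have := Real.pi_pos
      positivity
  have hset : (Ici a ∩ Ioi 0 : Set ℝ) =ᵐ[volume] (Ioi (a ⊔ 0) : Set ℝ) := by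
    rw [← Ioi_inter_Ioi]
    exact Ioi_ae_eq_Ici.symm.inter (ae_eq_refl _)
  rw [hleft, withDensity_apply _ measurableSet_Ici, Measure.restrict_restrict measurableSet_Ici,
    setLIntegral_congr hset, ← ofReal_integral_eq_lintegral_ofReal
      N.integrable_servingDensity.integrableOn, integral_servingDensity]
  filter_upwards [ae_restrict_mem measurableSet_Ioi] with r hr
  exact N.servingDensity_nonneg (le_sup_right.trans (mem_Ioi.1 hr).le)

/-! ### The packet loss rate -/

lemma measurable_lossIntegrand : Measurable N.lossIntegrand := by
  unfold lossIntegrand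
  fun_prop

lemma lossIntegrand_eq {r : ℝ} :
    2 * Real.pi * N.φb * N.lossIntegrand r = N.servingDensity r *
      (Real.exp (-(N.gainScale r * N.σsq))
        * Real.exp (-(Real.pi * r ^ 2 * (N.φa * N.Z₁ N.threshold)))) := by
  rw [lossIntegrand, servingDensity, gainScale]
  have : Real.exp (-(r ^ N.β * N.P⁻¹ * N.threshold * N.σsq)
      - Real.pi * r ^ 2 * (N.φa * N.Z₁ N.threshold + N.φb))
      = Real.exp (-(Real.pi * N.φb) * r ^ 2)
        * (Real.exp (-(N.threshold * r ^ N.β / N.P * N.σsq))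
        * Real.exp (-(Real.pi * r ^ 2 * (N.φa * N.Z₁ N.threshold)))) := by
    rw [← Real.exp_add, ← Real.exp_add]
    congr 1
    ring
  rw [this]
  ring

lemma integrableOn_lossIntegrand : IntegrableOn N.lossIntegrand (Ioi 0) := by
  have hc : 0 < Real.pi * N.φb := mul_pos Real.pi_pos N.φb_pos
  refine Integrable.mono' (integrable_mul_exp_neg_mul_sq hc).integrableOn
    N.measurable_lossIntegrand.aestronglyMeasurable ?_
  filter_upwards [ae_restrict_mem measurableSet_Ioi] with r hr
  have hr : 0 < r := hr
  have := N.P_pos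
  have := N.threshold_pos
  have := N.σsq_pos
  have h1 : 0 ≤ r ^ N.β * N.P⁻¹ * N.threshold * N.σsq := by positivity
  have h2 : 0 ≤ Real.pi * r ^ 2 * (N.φa * N.Z₁ N.threshold) := by
    have := N.Z₁_threshold_nonneg
    have := N.activeProb_nonneg
    have := N.φb_pos
    have := Real.pi_pos
    rw [φa]
    positivity
  rw [lossIntegrand, Real.norm_of_nonneg (by positivity)]
  gcongr
  linarith

lemma lintegral_servingDist_factors (hX : IsPoissonPointProcess X N.φb μ) :
    ∫⁻ ω, N.noiseFactor (servingDist fun k => X k ω)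
        * N.exteriorFactor (servingDist fun k => X k ω) ∂μ
      = ENNReal.ofReal (2 * Real.pi * N.φb * ∫ r in Ioi 0, N.lossIntegrand r) := by
  have hDm : Measurable fun ω => servingDist fun k => X k ω :=
    measurable_servingDist.comp (measurable_pi_lambda _ hX.measurable)
  have hF : Measurable fun r => N.noiseFactor r * N.exteriorFactor r :=
    N.continuous_noiseFactor.measurable.mul N.continuous_exteriorFactor.measurable
  rw [← lintegral_map hF hDm, N.map_servingDist_eq hX,
    lintegral_withDensity_eq_lintegral_mul _ N.measurable_servingDensity.ennreal_ofReal hF,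
    ← integral_const_mul, ofReal_integral_eq_lintegral_ofReal
      (N.integrableOn_lossIntegrand.const_mul _)]
  · refine setLIntegral_congr_fun measurableSet_Ioi fun r (hr : 0 < r) => ?_
    simp only [Pi.mul_apply, noiseFactor, exteriorFactor]
    rw [lossIntegrand_eq, ENNReal.ofReal_mul (N.servingDensity_nonneg hr.le),
      ENNReal.ofReal_mul (Real.exp_pos _).le]
  · filter_upwards [ae_restrict_mem measurableSet_Ioi] with r hr
    rw [Pi.zero_apply, lossIntegrand_eq]
    have := N.servingDensity_nonneg (mem_Ioi.1 hr).le
    positivity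

lemma measurable_interferenceTerm (k : ℕ) : Measurable fun p : (ℕ → Plane) × (ℕ → Bool × ℂ) =>
    N.interferenceTerm p.1 (fun k => (p.2 k).2) (fun k => (p.2 k).1) k := by
  have h1 : MeasurableSet {p : (ℕ → Plane) × (ℕ → Bool × ℂ) | k ≠ serving p.1} := by
    have hs : Measurable fun p : (ℕ → Plane) × (ℕ → Bool × ℂ) => serving p.1 :=
      measurable_serving.comp measurable_fst
    have := (hs (measurableSet_singleton k)).compl
    convert! this using 1
    ext p
    simp [eq_comm]
  have h2 : MeasurableSet {p : (ℕ → Plane) × (ℕ → Bool × ℂ) | (p.2 k).1 = true} :=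
    (by fun_prop : Measurable fun p : (ℕ → Plane) × (ℕ → Bool × ℂ) => (p.2 k).1)
      (measurableSet_singleton true)
  exact Measurable.ite (h1.inter h2) (by unfold receivedPower; fun_prop) measurable_const

lemma measurable_sinr : Measurable fun p : (ℕ → Plane) × (ℕ → Bool × ℂ) =>
    N.sinr p.1 (fun k => (p.2 k).2) (fun k => (p.2 k).1) := by
  have h1 : Measurable fun q : ((ℕ → Plane) × (ℕ → Bool × ℂ)) × ℕ =>
      N.receivedPower q.1.1 (fun k => (q.1.2 k).2) q.2 :=
    measurable_from_prod_countable_left fun k => by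
      change Measurable fun p : (ℕ → Plane) × (ℕ → Bool × ℂ) =>
        N.P * ‖(p.2 k).2‖ ^ 2 * ‖p.1 k‖ ^ (-N.β)
      fun_prop
  have h2 : Measurable fun p : (ℕ → Plane) × (ℕ → Bool × ℂ) => (p, serving p.1) :=
    measurable_id'.prodMk (measurable_serving.comp measurable_fst)
  have h3 := h1.comp h2
  have h4 : Measurable fun p : (ℕ → Plane) × (ℕ → Bool × ℂ) =>
      ∑' k, N.interferenceTerm p.1 (fun k => (p.2 k).2) (fun k => (p.2 k).1) k :=
    Measurable.tsum N.measurable_interferenceTerm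
  exact h3.div (h4.add_const N.σsq)

lemma sinr_nonneg (x : ℕ → Plane) (g : ℕ → ℂ) (act : ℕ → Bool) : 0 ≤ N.sinr x g act :=
  div_nonneg (N.receivedPower_nonneg _ _ _)
    (add_nonneg (tsum_nonneg fun k => N.interferenceTerm_nonneg x g act k) N.σsq_pos.le)

lemma throughput_lt_iff {s : ℝ} (hs : 0 ≤ s) :
    N.τ * N.B * Real.logb 2 (1 + s) < N.T ↔ ¬N.threshold ≤ s := by
  have h : 0 < N.τ * N.B := mul_pos N.τ_pos N.B_pos
  rw [← lt_div_iff₀' h, Real.logb_lt_iff_lt_rpow one_lt_two (by linarith), threshold, not_le,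
    lt_sub_iff_add_lt']

end CacheNetwork

end

/-- The packet loss rate of a cache-untenable user at the origin. The base stations `X` form a
Poisson point process of intensity `φ_b`; independently of their positions, each of them is active
with probability `1 - p_0 + p_0 p_t` and has a Rayleigh fading channel `h` to the user, all
independent. The interference is almost surely finite and the integral converges. -/
theorem theorem2 (N : CacheNetwork) {Ω : Type*} [MeasurableSpace Ω]
    (μ : Measure Ω) [IsProbabilityMeasure μ]
    (X : ℕ → Ω → Plane) (h : ℕ → Ω → ℂ) (act : ℕ → Ω → Bool)
    (hX : IsPoissonPointProcess X N.φb μ)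
    (h_meas : ∀ k, Measurable (h k))
    (h_law : ∀ k, HasLaw (fun ω => ‖h k ω‖ ^ 2) (expMeasure 1) μ)
    (act_meas : ∀ k, Measurable (act k))
    (act_law : ∀ k, μ {ω | act k ω = true} = ENNReal.ofReal N.activeProb)
    (act_indep_h : ∀ k, IndepFun (act k) (h k) μ)
    (marks_indep : iIndepFun (fun k ω => (act k ω, h k ω)) μ)
    (X_indep_marks : IndepFun (fun ω k => X k ω) (fun ω k => (act k ω, h k ω)) μ) :
    (∀ᵐ ω ∂μ, Summable
      (N.interferenceTerm (fun k => X k ω) (fun k => h k ω) (fun k => act k ω))) ∧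
    IntegrableOn N.lossIntegrand (Set.Ioi 0) ∧
    N.packetLossRate μ X h act =
      1 - 2 * Real.pi * N.φb * ∫ r in Set.Ioi (0 : ℝ), N.lossIntegrand r := by
  have hXm : Measurable fun ω k => X k ω := measurable_pi_lambda _ hX.measurable
  have hWm : Measurable fun ω k => (act k ω, h k ω) :=
    measurable_pi_lambda _ fun k => (act_meas k).prodMk (h_meas k)
  have hp1 : N.activeProb ≤ 1 := by
    have := prob_le_one (μ := μ) (s := {ω | act 0 ω = true})
    rwa [act_law 0, ENNReal.ofReal_le_one] at this
  have hreg := hX.ae_isRegularConfiguration N.φb_pos.le N.two_lt_β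
  -- positions and marks are independent, so events may be computed for fixed positions first
  have hfubini : ∀ S : Set ((ℕ → Plane) × (ℕ → Bool × ℂ)), MeasurableSet S →
      μ {ω | ((fun k => X k ω), fun k => (act k ω, h k ω)) ∈ S}
        = ∫⁻ ω, μ {ω' | ((fun k => X k ω), fun k => (act k ω', h k ω')) ∈ S} ∂μ := fun S hS => by
    have hmap := (indepFun_iff_map_prod_eq_prod_map_map hXm.aemeasurable hWm.aemeasurable).1
      X_indep_marks
    have h1 : μ {ω | ((fun k => X k ω), fun k => (act k ω, h k ω)) ∈ S}
        = μ.map (fun ω => ((fun k => X k ω), fun k => (act k ω, h k ω))) S :=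
      (Measure.map_apply (hXm.prodMk hWm) hS).symm
    have := Measure.isProbabilityMeasure_map (μ := μ) hWm.aemeasurable
    rw [h1, hmap, Measure.prod_apply hS, lintegral_map (measurable_measure_prodMk_left hS) hXm]
    refine lintegral_congr fun ω => ?_
    rw [Measure.map_apply hWm (measurable_prodMk_left hS)]
    rfl
  refine ⟨?_, N.integrableOn_lossIntegrand, ?_⟩
  · set S : Set ((ℕ → Plane) × (ℕ → Bool × ℂ)) := {p | ∑' k, ENNReal.ofReal
      (N.interferenceTerm p.1 (fun k => (p.2 k).2) (fun k => (p.2 k).1) k) = ⊤} with hSdef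
    have hS : MeasurableSet S :=
      Measurable.tsum (fun k => (N.measurable_interferenceTerm k).ennreal_ofReal)
        (measurableSet_singleton ⊤)
    have hzero : μ {ω | ((fun k => X k ω), fun k => (act k ω, h k ω)) ∈ S} = 0 := by
      rw [hfubini S hS]
      refine (lintegral_congr_ae ?_).trans lintegral_zero
      filter_upwards [hreg] with ω hω
      refine measure_mono_null ?_
        (ae_iff.1 (N.ae_summable_interferenceTerm (act := act) h_meas h_law hω))
      intro ω' hω'
      change ¬Summable _
      exact fun hsum => hsum.tsum_ofReal_ne_top hω'
    have hae : ∀ᵐ ω ∂μ, ((fun k => X k ω), fun k => (act k ω, h k ω)) ∉ S := by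
      rw [ae_iff]
      simpa only [not_not] using hzero
    filter_upwards [hae] with ω hω
    refine (ENNReal.summable_toReal hω).congr fun k => ?_
    exact ENNReal.toReal_ofReal (N.interferenceTerm_nonneg _ _ _ _)
  · set S : Set ((ℕ → Plane) × (ℕ → Bool × ℂ)) := {p | N.threshold ≤
      N.sinr p.1 (fun k => (p.2 k).2) (fun k => (p.2 k).1)} with hSdef
    have hS : MeasurableSet S := measurableSet_le measurable_const N.measurable_sinr
    set E : Set Ω := {ω | ((fun k => X k ω), fun k => (act k ω, h k ω)) ∈ S} with hE
    have hEm : MeasurableSet E := (hXm.prodMk hWm) hS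
    have hprob : μ E = ENNReal.ofReal
        (2 * Real.pi * N.φb * ∫ r in Ioi 0, N.lossIntegrand r) := by
      rw [hE, hfubini S hS, ← N.lintegral_servingDist_factors hX, ← N.lintegral_success_eq hX hp1]
      refine lintegral_congr_ae ?_
      filter_upwards [hreg] with ω hω
      exact N.measure_threshold_le_sinr hp1 h_meas h_law act_meas act_law act_indep_h
        marks_indep hω
    have hnn : 0 ≤ 2 * Real.pi * N.φb * ∫ r in Ioi 0, N.lossIntegrand r := by
      rw [← integral_const_mul]
      refine setIntegral_nonneg measurableSet_Ioi fun r (hr : 0 < r) => ?_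
      rw [N.lossIntegrand_eq]
      have := N.servingDensity_nonneg hr.le
      positivity
    have hloss : {ω | N.τ * N.B * Real.logb 2
        (1 + N.sinr (fun k => X k ω) (fun k => h k ω) (fun k => act k ω)) < N.T} = Eᶜ := by
      ext ω
      exact N.throughput_lt_iff (N.sinr_nonneg _ _ _)
    rw [CacheNetwork.packetLossRate, hloss, probReal_compl_eq_one_sub hEm, measureReal_def, hprob,
      ENNReal.toReal_ofReal hnn]
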